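/- Let $\mathbb K$ be an algebraically closed field of characteristic zero, let $0\le s\le m-1$ be integers, let $G={\rm SL}(m)$ act diagonally on $({\mathbb K}^m)^s$, and let $F=G_{(e_1,\dots,e_s)}$ be the isotropy group of the tuple of the first $s$ standard basis vectors. Then $$F=\left\{\begin{bmatrix}E_s & A\\ 0& B\end{bmatrix};\ B\in{\rm SL}(m-s),\ A\in{\rm Mat}(s\times(m-s))\right\},$$ and the following hold. (i) $F$ is a connected Grosshans subgroup of $G$, i.e. $F$ is closed and connected, $G/F$ is a quasiaffine variety, and the algebra $\mathcal O(G)^F$ of regular functions on $G$ invariant under right translation by $F$ is finitely generated. (ii) Let $\pi\colon N_G(F)\to N_G(F)/F$ be the projection. Sending a matrix to its upper left $s\times s$ block induces an isomorphism of algebraic groups $N_G(F)/F\cong{\rm GL}(s)$. The group $$T'_F=\{{\rm diag}(t_1,\dots,t_s,t^{-1},1,\dots,1);\ t_i\in{\mathbb K}^*,\ t=t_1\cdots t_s\}$$ is contained in $N_G(F)$, and $\pi$ maps $T'_F$ isomorphically (as algebraic groups) onto a maximal torus $T_F$ of $N_G(F)/F$. (iii) The orbit map $g\mapsto g\cdot(e_1,\dots,e_s)$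 induces an isomorphism $Z:={\rm Spec}(\mathcal O(G)^F)\cong({\mathbb K}^m)^s$ (it identifies the polynomial ring in the $ms$ coordinates with $\mathcal O(G)^F$). For the action of $N_G(F)/F$ on $Z$ extending $nF\cdot gF=gn^{-1}F$ on $G/F$, the torus $T_F$ acts on $Z$ by $$t\cdot(v_1,\dots,v_s)=(t_1^{-1}v_1,\dots,t_s^{-1}v_s),$$ where $t\in T_F$ is the image of ${\rm diag}(t_1,\dots,t_s,t^{-1},1,\dots,1)$ with $t=t_1\cdots t_s$ in this matrix. (iv) For $z\in Z$ let the orbit cone $\omega(z)\subset{\mathbb X}_{\mathbb Q}(T_F)={\mathbb Q}\otimes_{\mathbb Z}{\mathbb X}(T_F)$ be the convex cone generated by all characters $\chi$ of $T_F$ that admit an $f\in\mathcal O(Z)$ with $f(t\cdot z')=\chi(t)f(z')$ for all $t\in T_F$, $z'\in Z$, and with $f(z)\ne0$. The $ms$ coordinate functions on $Z=({\mathbb K}^m)^s$ are $T_F$-homogeneous prime elements generating $\mathcal O(G)^F$, and every cone in ${\mathbb X}_{\mathbb Q}(T_F)$ generated by the weights of some of them is an orbit cone $\omega(z)$, $z\in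 Z$. In particular, $F$ is suitable, where a connected Grosshans subgroup $F\subset G$ is called suitable if, for a maximal torus $T_F$ of $N_G(F)/F$, the algebra $\mathcal O(G)^F$ has a finite system of $T_F$-homogeneous prime generators such that every cone in ${\mathbb X}_{\mathbb Q}(T_F)$ spanned by some of their weights is an orbit cone of the $T_F$-action on $Z={\rm Spec}(\mathcal O(G)^F)$. -/

import Mathlib

/-- A space with functions over a field `K`: a topological space with a sheaf of `K`-valued
functions.  `reg U` consists of the functions `f : X → K` whose restriction to `U` is regular
(the values of `f` outside of `U` are irrelevant). -/
structure SpaceWithFunctions (K : Type*) [Field K] (X : Type*) where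
  top : TopologicalSpace X
  reg : Set X → Subalgebra K (X → K)
  reg_congr : ∀ (U : Set X) (f g : X → K), Set.EqOn f g U → f ∈ reg U → g ∈ reg U
  reg_mono : ∀ (U V : Set X), V ⊆ U → reg U ≤ reg V
  reg_local : ∀ (U : Set X) (f : X → K), top.IsOpen U →
    (∀ x ∈ U, ∃ V, top.IsOpen V ∧ x ∈ V ∧ V ⊆ U ∧ f ∈ reg V) → f ∈ reg U

section Generic

/-- Pullback of `K`-valued functions along a map, as a homomorphism of `K`-algebras. -/
def pullbackFun (K : Type*) [Field K] {X Y : Type*} (φ : X → Y) : (Y → K) →ₐ[K] (X → K) where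
  toFun f := f ∘ φ
  map_one' := rfl
  map_mul' _ _ := rfl
  map_zero' := rfl
  map_add' _ _ := rfl
  commutes' _ := rfl

/-- The functions on a subset obtained by restricting the functions in `A`. -/
def restrictAlg {K : Type*} [Field K] {X : Type*} (A : Subalgebra K (X → K)) (S : Set X) :
    Subalgebra K (S → K) :=
  A.map (pullbackFun K (Subtype.val : S → X))

/-- The functions on `Y` whose pullback along `π : X → Y` lies in `A` (used for quotients). -/
def descendAlg {K : Type*} [Field K] {X Y : Type*} (A : Subalgebra K (X → K)) (π : X → Y) :
    Subalgebra K (Y → K) :=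
  A.comap (pullbackFun K π)

/-- `φ` is an isomorphism from the affine variety `X` with coordinate algebra `A` onto the
affine variety `Y` with coordinate algebra `B`. -/
def IsAffineIso {K : Type*} [Field K] {X Y : Type*}
    (A : Subalgebra K (X → K)) (B : Subalgebra K (Y → K)) (φ : X → Y) : Prop :=
  Function.Bijective φ ∧ ∀ f : Y → K, f ∈ B ↔ f ∘ φ ∈ A

/-- The Zariski topology defined by an algebra of functions: the sets `{h ≠ 0}`, `h ∈ A`,
form a basis of the topology. -/
@[reducible] def zariski {K : Type*} [Field K] {X : Type*} (A : Subalgebra K (X → K)) :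
    TopologicalSpace X where
  IsOpen U := ∀ x ∈ U, ∃ h ∈ A, h x ≠ 0 ∧ ∀ y, h y ≠ 0 → y ∈ U
  isOpen_univ := fun _ _ => ⟨1, A.one_mem, one_ne_zero, fun _ _ => trivial⟩
  isOpen_inter := by
    rintro U V hU hV x ⟨hxU, hxV⟩
    obtain ⟨h, hA, hx, hh⟩ := hU x hxU
    obtain ⟨k, kA, kx, hk⟩ := hV x hxV
    refine ⟨h * k, A.mul_mem hA kA, mul_ne_zero hx kx, fun y hy => ?_⟩
    exact ⟨hh y (left_ne_zero_of_mul hy), hk y (right_ne_zero_of_mul hy)⟩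
  isOpen_sUnion := by
    rintro S hS x ⟨U, hU, hxU⟩
    obtain ⟨h, hA, hx, hh⟩ := hS U hU x hxU
    exact ⟨h, hA, hx, fun y hy => ⟨U, hU, hh y hy⟩⟩

/-- The space with functions defined by an algebra `A` of functions on `X`: the topology is the
Zariski topology, and a function is regular if it is locally a fraction of elements of `A`.
For the restrictions of the polynomials to a Zariski locally closed subset of affine space this
is the usual structure of a quasiaffine variety. -/
def SpaceWithFunctions.ofAlg {K : Type*} [Field K] {X : Type*} (A : Subalgebra K (X → K)) :
    SpaceWithFunctions K X where
  top := zariski A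
  reg U :=
    { carrier := {f | ∀ x ∈ U, ∃ p ∈ A, ∃ q ∈ A, q x ≠ 0 ∧
        ∀ y ∈ U, q y ≠ 0 → f y = p y / q y}
      mul_mem' := by
        intro f g hf hg x hx
        obtain ⟨p, hp, q, hq, hqx, h⟩ := hf x hx
        obtain ⟨p', hp', q', hq', hqx', h'⟩ := hg x hx
        refine ⟨p * p', A.mul_mem hp hp', q * q', A.mul_mem hq hq', mul_ne_zero hqx hqx', ?_⟩
        intro y hy hqy
        have h1 : q y ≠ 0 := left_ne_zero_of_mul hqy
        have h2 : q' y ≠ 0 := right_ne_zero_of_mul hqy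
        simp only [Pi.mul_apply, h y hy h1, h' y hy h2]
        field_simp
      add_mem' := by
        intro f g hf hg x hx
        obtain ⟨p, hp, q, hq, hqx, h⟩ := hf x hx
        obtain ⟨p', hp', q', hq', hqx', h'⟩ := hg x hx
        refine ⟨p * q' + p' * q, A.add_mem (A.mul_mem hp hq') (A.mul_mem hp' hq),
          q * q', A.mul_mem hq hq', mul_ne_zero hqx hqx', ?_⟩
        intro y hy hqy
        have h1 : q y ≠ 0 := left_ne_zero_of_mul hqy
        have h2 : q' y ≠ 0 := right_ne_zero_of_mul hqy
        simp only [Pi.mul_apply, Pi.add_apply, h y hy h1, h' y hy h2]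
        field_simp
      algebraMap_mem' := by
        intro c x _
        exact ⟨algebraMap K (X → K) c, A.algebraMap_mem c, 1, A.one_mem, one_ne_zero,
          fun y _ _ => by simp⟩ }
  reg_congr := by
    intro U f g hfg hf x hx
    obtain ⟨p, hp, q, hq, hqx, h⟩ := hf x hx
    exact ⟨p, hp, q, hq, hqx, fun y hy hqy => by rw [← hfg hy, h y hy hqy]⟩
  reg_mono := by
    intro U V hVU f hf x hx
    obtain ⟨p, hp, q, hq, hqx, h⟩ := hf x (hVU hx)
    exact ⟨p, hp, q, hq, hqx, fun y hy hqy => h y (hVU hy) hqy⟩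
  reg_local := by
    intro U f _ hloc x hx
    obtain ⟨V, hV, hxV, hVU, hf⟩ := hloc x hx
    obtain ⟨k, hk, hkx, hkV⟩ := hV x hxV
    obtain ⟨p, hp, q, hq, hqx, h⟩ := hf x hxV
    refine ⟨p * k, A.mul_mem hp hk, q * k, A.mul_mem hq hk, mul_ne_zero hqx hkx, ?_⟩
    intro y _ hy
    have h1 : q y ≠ 0 := left_ne_zero_of_mul hy
    have h2 : k y ≠ 0 := right_ne_zero_of_mul hy
    rw [h y (hkV y h2) h1]
    simp only [Pi.mul_apply]
    field_simp

/-- The quotient of a space with functions: a set is open, or a function on it is regular, if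
its pullback is.  For a closed subgroup `H` of a linear algebraic group `G` in characteristic
zero, this is the variety `G/H`. -/
def SpaceWithFunctions.quot {K : Type*} [Field K] {X Y : Type*} (S : SpaceWithFunctions K X)
    (π : X → Y) : SpaceWithFunctions K Y where
  top := S.top.coinduced π
  reg U := descendAlg (S.reg (π ⁻¹' U)) π
  reg_congr U f g hfg hf :=
    S.reg_congr (π ⁻¹' U) (f ∘ π) (g ∘ π) (fun x hx => hfg (show π x ∈ U from hx)) hf
  reg_mono U V hVU f hf := S.reg_mono (π ⁻¹' U) (π ⁻¹' V) (Set.preimage_mono hVU) hf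
  reg_local U f hU hloc := by
    refine S.reg_local (π ⁻¹' U) (f ∘ π) hU fun x hx => ?_
    obtain ⟨V, hV, hxV, hVU, hf⟩ := hloc (π x) hx
    exact ⟨π ⁻¹' V, hV, hxV, Set.preimage_mono hVU, hf⟩

/-- Isomorphisms of spaces with functions. -/
def SpaceWithFunctions.IsIso {K : Type*} [Field K] {X Y : Type*} (S : SpaceWithFunctions K X)
    (S' : SpaceWithFunctions K Y) (φ : X → Y) : Prop :=
  Function.Bijective φ ∧
  (∀ V : Set Y, S'.top.IsOpen V ↔ S.top.IsOpen (φ ⁻¹' V)) ∧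
  ∀ V : Set Y, S'.top.IsOpen V → ∀ f : Y → K, f ∈ S'.reg V ↔ f ∘ φ ∈ S.reg (φ ⁻¹' V)

/-- The polynomial functions on affine `n`-space. -/
def polyAlg (K : Type*) [Field K] (n : ℕ) : Subalgebra K ((Fin n → K) → K) :=
  Algebra.adjoin K (Set.range fun (i : Fin n) (x : Fin n → K) => x i)

/-- A space with functions is a quasiaffine variety if it is isomorphic to a Zariski locally
closed subset of some affine space (i.e. to an open subset of an affine variety). -/
def SpaceWithFunctions.IsQuasiaffine {K : Type*} [Field K] {X : Type*}
    (S : SpaceWithFunctions K X) : Prop :=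
  ∃ (n : ℕ) (L : Set (Fin n → K)), @IsLocallyClosed _ (zariski (polyAlg K n)) L ∧
    ∃ φ : X → L, S.IsIso (SpaceWithFunctions.ofAlg (restrictAlg (polyAlg K n) L)) φ

/-- The algebra of regular functions (Laurent polynomials) on the standard torus `(K^*)^r`. -/
def laurentAlg (K : Type*) [Field K] (r : ℕ) : Subalgebra K ((Fin r → Kˣ) → K) :=
  Algebra.adjoin K
    ((Set.range fun (i : Fin r) (t : Fin r → Kˣ) => (t i : K)) ∪
      (Set.range fun (i : Fin r) (t : Fin r → Kˣ) => ((t i)⁻¹ : K)))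

/-- `T` is a torus in the linear algebraic group `Q` with coordinate algebra `A`: a closed
subgroup isomorphic, as an algebraic group, to some `(K^*)^r`. -/
def IsTorus {K : Type*} [Field K] {Q : Type*} [Group Q] (A : Subalgebra K (Q → K))
    (T : Subgroup Q) : Prop :=
  @IsClosed _ (zariski A) (T : Set Q) ∧
    ∃ (r : ℕ) (e : (Fin r → Kˣ) →* T), IsAffineIso (laurentAlg K r) (restrictAlg A (T : Set Q)) e

/-- Maximal tori: tori that are maximal with respect to inclusion. -/
def IsMaximalTorus {K : Type*} [Field K] {Q : Type*} [Group Q] (A : Subalgebra K (Q → K))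
    (T : Subgroup Q) : Prop :=
  Maximal (IsTorus A) T

/-- The character group `𝕏(T)` of a linear algebraic group `T` with coordinate algebra `A`:
the homomorphisms `χ : T → K^*` such that `χ` and `χ⁻¹` are regular functions. -/
def charGroup {K : Type*} [Field K] {T : Type*} [Group T] (A : Subalgebra K (T → K)) :
    Subgroup (T →* Kˣ) where
  carrier := {χ | (fun x => ((χ x : Kˣ) : K)) ∈ A ∧ (fun x => (((χ x)⁻¹ : Kˣ) : K)) ∈ A}
  one_mem' := by
    have h1 : (fun x => (((1 : T →* Kˣ) x : Kˣ) : K)) = 1 := by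
      funext x; simp
    have h2 : (fun x => ((((1 : T →* Kˣ) x)⁻¹ : Kˣ) : K)) = 1 := by
      funext x; simp
    exact ⟨h1 ▸ A.one_mem, h2 ▸ A.one_mem⟩
  mul_mem' := by
    rintro χ ψ ⟨h1, h2⟩ ⟨h3, h4⟩
    refine ⟨A.mul_mem h1 h3, ?_⟩
    have e : (fun x => ((((χ * ψ) x)⁻¹ : Kˣ) : K))
        = (fun x => (((ψ x)⁻¹ : Kˣ) : K)) * fun x => (((χ x)⁻¹ : Kˣ) : K) := by
      funext x
      simp
    exact e ▸ A.mul_mem h4 h2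
  inv_mem' := by
    rintro χ ⟨h1, h2⟩
    exact ⟨by simpa using h2, by simpa using h1⟩

/-- The rational character space `𝕏_ℚ(T) = ℚ ⊗ 𝕏(T)`. -/
abbrev RatChar {K : Type*} [Field K] {T : Type*} [Group T] (A : Subalgebra K (T → K)) :=
  TensorProduct ℤ ℚ (Additive (charGroup A))

/-- The convex cone in `𝕏_ℚ(T)` generated by a set of characters. -/
def charCone {K : Type*} [Field K] {T : Type*} [Group T] (A : Subalgebra K (T → K))
    (S : Set (charGroup A)) : PointedCone ℚ (RatChar A) :=
  Submodule.span {c : ℚ // 0 ≤ c}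
    ((fun χ : charGroup A => TensorProduct.tmul ℤ (1 : ℚ) (Additive.ofMul χ)) '' S)

end Generic

section SL

/-- The group `SL(m)` of `K`-points. -/
abbrev SLm (K : Type*) [Field K] (m : ℕ) := Matrix.SpecialLinearGroup (Fin m) K

/-- The coordinate algebra `𝒪(SL(m))`, generated by the matrix entries. -/
def slAlg (K : Type*) [Field K] (m : ℕ) : Subalgebra K (SLm K m → K) :=
  Algebra.adjoin K (Set.range fun (p : Fin m × Fin m) (g : SLm K m) => g.1 p.1 p.2)

/-- The coordinate algebra `𝒪(GL(s))`, generated by the matrix entries and `1/det`. -/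
def glAlg (K : Type*) [Field K] (s : ℕ) : Subalgebra K (Matrix.GeneralLinearGroup (Fin s) K → K) :=
  Algebra.adjoin K
    ((Set.range fun (p : Fin s × Fin s) (g : Matrix.GeneralLinearGroup (Fin s) K) =>
        g.1 p.1 p.2) ∪
      {fun g : Matrix.GeneralLinearGroup (Fin s) K => (g.1.det)⁻¹})

theorem slAlg_rightTranslate {K : Type*} [Field K] {m : ℕ} (n : SLm K m) {f : SLm K m → K}
    (hf : f ∈ slAlg K m) : (fun g => f (g * n)) ∈ slAlg K m := by
  have key : slAlg K m ≤ (slAlg K m).comap (pullbackFun K fun g : SLm K m => g * n) := by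
    refine Algebra.adjoin_le ?_
    rintro _ ⟨⟨a, b⟩, rfl⟩
    change (fun g : SLm K m => (g * n).1 a b) ∈ slAlg K m
    have : (fun g : SLm K m => (g * n).1 a b)
        = ∑ c : Fin m, n.1 c b • (fun g : SLm K m => g.1 a c) := by
      funext g
      simp [Matrix.mul_apply, mul_comm]
    rw [this]
    exact Subalgebra.sum_mem _ fun c _ =>
      Subalgebra.smul_mem _ (Algebra.subset_adjoin (Set.mem_range_self (a, c))) _
  exact key hf

/-- The homogeneous space `G/F`, `G = SL(m)`, as a space with functions. -/
def homogSpace {K : Type*} [Field K] {m : ℕ} (F : Subgroup (SLm K m)) :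
    SpaceWithFunctions K (SLm K m ⧸ F) :=
  (SpaceWithFunctions.ofAlg (slAlg K m)).quot (QuotientGroup.mk : SLm K m → SLm K m ⧸ F)

/-- The algebra `𝒪(G)^F = 𝒪(G/F)` of regular functions on `G = SL(m)` that are invariant under
right translation by `F`. -/
def invAlg {K : Type*} [Field K] {m : ℕ} (F : Subgroup (SLm K m)) :
    Subalgebra K (SLm K m → K) where
  carrier := {f | f ∈ slAlg K m ∧ ∀ g, ∀ h ∈ F, f (g * h) = f g}
  mul_mem' := by
    rintro f f' ⟨h1, h2⟩ ⟨h3, h4⟩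
    refine ⟨Subalgebra.mul_mem _ h1 h3, fun g h hh => ?_⟩
    simp only [Pi.mul_apply, h2 g h hh, h4 g h hh]
  add_mem' := by
    rintro f f' ⟨h1, h2⟩ ⟨h3, h4⟩
    refine ⟨Subalgebra.add_mem _ h1 h3, fun g h hh => ?_⟩
    simp only [Pi.add_apply, h2 g h hh, h4 g h hh]
  algebraMap_mem' c := ⟨Subalgebra.algebraMap_mem _ c, fun _ _ _ => rfl⟩

/-- Observable subgroups of `G = SL(m)`: closed subgroups with `G/F` quasiaffine. -/
def IsObservable {K : Type*} [Field K] {m : ℕ} (F : Subgroup (SLm K m)) : Prop :=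
  @IsClosed _ (zariski (slAlg K m)) (F : Set (SLm K m)) ∧ (homogSpace F).IsQuasiaffine

/-- Grosshans subgroups of `G = SL(m)`: observable subgroups such that `𝒪(G)^F` is a finitely
generated algebra. -/
def IsGrosshans {K : Type*} [Field K] {m : ℕ} (F : Subgroup (SLm K m)) : Prop :=
  IsObservable F ∧ (invAlg F).FG

/-- `F` is connected in the Zariski topology of `G = SL(m)`. -/
def IsZariskiConnected {K : Type*} [Field K] {m : ℕ} (F : Subgroup (SLm K m)) : Prop :=
  @IsConnected _ (zariski (slAlg K m)) (F : Set (SLm K m))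

/-- The normalizer `N_G(F)`. -/
abbrev NormGrp {K : Type*} [Field K] {m : ℕ} (F : Subgroup (SLm K m)) : Subgroup (SLm K m) :=
  Subgroup.normalizer (F : Set (SLm K m))

/-- The group `N_G(F)/F`. -/
abbrev NormQuot {K : Type*} [Field K] {m : ℕ} (F : Subgroup (SLm K m)) :=
  NormGrp F ⧸ F.subgroupOf (NormGrp F)

/-- The projection `π : N_G(F) → N_G(F)/F`. -/
abbrev normProj {K : Type*} [Field K] {m : ℕ} (F : Subgroup (SLm K m)) : NormGrp F →* NormQuot F :=
  QuotientGroup.mk' (F.subgroupOf (NormGrp F))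

/-- The coordinate algebra of `N_G(F)`. -/
def normAlg {K : Type*} [Field K] {m : ℕ} (F : Subgroup (SLm K m)) :
    Subalgebra K (NormGrp F → K) :=
  restrictAlg (slAlg K m) (NormGrp F : Set (SLm K m))

/-- The coordinate algebra of the linear algebraic group `N_G(F)/F`: the functions that pull
back to regular functions on `N_G(F)`. -/
def normQuotAlg {K : Type*} [Field K] {m : ℕ} (F : Subgroup (SLm K m)) :
    Subalgebra K (NormQuot F → K) :=
  descendAlg (normAlg F) (normProj F)

/-- The action of `N_G(F)` on `𝒪(G)^F` by right translation, `(n · f)(g) = f(g n)`. -/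
def normRep {K : Type*} [Field K] {m : ℕ} (F : Subgroup (SLm K m)) :
    NormGrp F →* (invAlg F →ₐ[K] invAlg F) where
  toFun n :=
    ((pullbackFun K fun g : SLm K m => g * n).comp (invAlg F).val).codRestrict (invAlg F) (by
      rintro ⟨f, hf, hinv⟩
      refine ⟨slAlg_rightTranslate (n : SLm K m) hf, fun g h hh => ?_⟩
      change f (g * h * n) = f (g * n)
      have hn : (n : SLm K m)⁻¹ * h * n ∈ F :=
        (Subgroup.mem_normalizer_iff''.1 n.2 h).1 hh
      have := hinv (g * n) _ hn
      rw [← this]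
      congr 1
      group)
  map_one' := by
    ext f g
    change f.1 (g * 1) = f.1 g
    rw [mul_one]
  map_mul' n n' := by
    ext f g
    change f.1 (g * (n * n')) = f.1 (g * n * n')
    rw [mul_assoc]

/-- The induced action of `N_G(F)/F` on `𝒪(G)^F`. -/
def normQuotRep {K : Type*} [Field K] {m : ℕ} (F : Subgroup (SLm K m)) :
    NormQuot F →* (invAlg F →ₐ[K] invAlg F) :=
  QuotientGroup.lift (F.subgroupOf (NormGrp F)) (normRep F) (by
    intro n hn
    ext f g
    exact f.2.2 g n (Subgroup.mem_subgroupOf.1 hn))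

/-- The (closed) points of `Z = Spec(𝒪(G)^F)`. -/
abbrev ZPt {K : Type*} [Field K] {m : ℕ} (F : Subgroup (SLm K m)) := invAlg F →ₐ[K] K

/-- The point of `Z` given by the coset `gF`, i.e. the image of `gF` under `G/F → Z`. -/
def ZPt.ofGroup {K : Type*} [Field K] {m : ℕ} (F : Subgroup (SLm K m)) (g : SLm K m) : ZPt F :=
  (Pi.evalAlgHom K (fun _ : SLm K m => K) g).comp (invAlg F).val

/-- The action of `N_G(F)/F` on `Z`.  It extends the action `nF · gF = g n⁻¹ F` on `G/F`. -/
def zAct {K : Type*} [Field K] {m : ℕ} {F : Subgroup (SLm K m)} (q : NormQuot F) (z : ZPt F) :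
    ZPt F :=
  z.comp (normQuotRep F q⁻¹)

theorem zAct_ofGroup {K : Type*} [Field K] {m : ℕ} (F : Subgroup (SLm K m)) (n : NormGrp F)
    (g : SLm K m) : zAct (normProj F n) (ZPt.ofGroup F g) = ZPt.ofGroup F (g * (n : SLm K m)⁻¹) :=
  rfl

/-- The character group of a subgroup `T` of `N_G(F)/F`. -/
abbrev TChar {K : Type*} [Field K] {m : ℕ} {F : Subgroup (SLm K m)}
    (T : Subgroup (NormQuot F)) :=
  charGroup (restrictAlg (normQuotAlg F) (T : Set (NormQuot F)))

/-- `f ∈ 𝒪(Z)` is `T`-homogeneous of weight `χ`, i.e. `f(t · z) = χ(t) f(z)`. -/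
def IsHomogOfWeight {K : Type*} [Field K] {m : ℕ} {F : Subgroup (SLm K m)}
    (T : Subgroup (NormQuot F)) (χ : TChar T) (f : invAlg F) : Prop :=
  ∀ (t : T) (z : ZPt F), zAct (t : NormQuot F) z f = ((χ.1 t : Kˣ) : K) * z f

/-- The orbit cone `ω(z) ⊆ 𝕏_ℚ(T)`, generated by the weights `χ` that admit a homogeneous
function `f` of weight `χ` with `f(z) ≠ 0`. -/
def orbitCone {K : Type*} [Field K] {m : ℕ} {F : Subgroup (SLm K m)}
    (T : Subgroup (NormQuot F)) (z : ZPt F) :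
    PointedCone ℚ (RatChar (restrictAlg (normQuotAlg F) (T : Set (NormQuot F)))) :=
  charCone _ {χ : TChar T | ∃ f : invAlg F, IsHomogOfWeight T χ f ∧ z f ≠ 0}

/-- A finite system of `T`-homogeneous prime generators of `𝒪(G)^F` such that every cone spanned
by some of their weights is an orbit cone of the `T`-action on `Z`. -/
def IsSuitableSystem {K : Type*} [Field K] {m : ℕ} {F : Subgroup (SLm K m)}
    (T : Subgroup (NormQuot F)) {ι : Type*} (f : ι → invAlg F) : Prop :=
  Finite ι ∧ (∀ i, Prime (f i)) ∧ Algebra.adjoin K (Set.range f) = ⊤ ∧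
    ∃ χ : ι → TChar T, (∀ i, IsHomogOfWeight T (χ i) (f i)) ∧
      ∀ J : Set ι, ∃ z : ZPt F, orbitCone T z = charCone _ (χ '' J)

/-- Suitable subgroups of `G = SL(m)`: connected Grosshans subgroups that admit a suitable system
for a maximal torus `T` of `N_G(F)/F`.  (All maximal tori are conjugate, so the choice of `T` is
irrelevant.) -/
def IsSuitable {K : Type*} [Field K] {m : ℕ} (F : Subgroup (SLm K m)) : Prop :=
  IsZariskiConnected F ∧ IsGrosshans F ∧
    ∃ T : Subgroup (NormQuot F), IsMaximalTorus (normQuotAlg F) T ∧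
      ∃ (r : ℕ) (f : Fin r → invAlg F), IsSuitableSystem T f

end SL

section Example

/-- The diagonal action of `SL(m)` on `(K^m)^s`. -/
def diagAct {K : Type*} [Field K] {m s : ℕ} (g : SLm K m) (v : Fin s → Fin m → K) :
    Fin s → Fin m → K :=
  fun i => g.1.mulVec (v i)

/-- The tuple `(e_1, …, e_s)` of the first `s` standard basis vectors of `K^m`. -/
def stdTuple (K : Type*) [Field K] {m s : ℕ} (h : s ≤ m) : Fin s → Fin m → K :=
  fun i => Pi.single (Fin.castLE h i) 1

/-- The isotropy group of `(e_1, …, e_s)` in `SL(m)`. -/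
def stabF (K : Type*) [Field K] {m s : ℕ} (h : s ≤ m) : Subgroup (SLm K m) where
  carrier := {g | diagAct g (stdTuple K h) = stdTuple K h}
  one_mem' := by
    funext i
    simp [diagAct]
  mul_mem' := by
    intro g g' hg hg'
    funext i
    have h1 := congrFun hg i
    have h2 := congrFun hg' i
    simp only [diagAct] at h1 h2 ⊢
    rw [Matrix.SpecialLinearGroup.coe_mul, ← Matrix.mulVec_mulVec, h2, h1]
  inv_mem' := by
    intro g hg
    funext i
    have h1 := congrFun hg i
    simp only [diagAct] at h1 ⊢
    conv_lhs => rw [← h1]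
    rw [Matrix.mulVec_mulVec, ← Matrix.SpecialLinearGroup.coe_mul, inv_mul_cancel]
    simp

/-- The division of the indices `1, …, m` into the first `s` and the last `m - s` ones. -/
def blockEquiv {m s : ℕ} (h : s ≤ m) : Fin s ⊕ Fin (m - s) ≃ Fin m :=
  finSumFinEquiv.trans (finCongr (Nat.add_sub_cancel' h))

/-- The diagonal entries of `diag(t_1, …, t_s, t⁻¹, 1, …, 1)`, where `t = t_1 ⋯ t_s`. -/
def torusDiag {K : Type*} [Field K] {m s : ℕ} (t : Fin s → Kˣ) (a : Fin m) : Kˣ :=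
  if ha : (a : ℕ) < s then t ⟨a, ha⟩ else if (a : ℕ) = s then (∏ i, t i)⁻¹ else 1

theorem prod_torusDiag {K : Type*} [Field K] {m s : ℕ} (h : s < m) (t : Fin s → Kˣ) :
    ∏ a : Fin m, torusDiag t a = 1 := by
  rw [← (blockEquiv h.le).prod_comp, Fintype.prod_sum_type]
  have h1 : ∀ i : Fin s, torusDiag t (blockEquiv h.le (Sum.inl i)) = t i := by
    intro i
    simp [torusDiag, blockEquiv]
  have h2 : ∀ j : Fin (m - s), torusDiag t (blockEquiv h.le (Sum.inr j))
      = if j = ⟨0, by omega⟩ then (∏ i, t i)⁻¹ else 1 := by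
    intro j
    simp [torusDiag, blockEquiv, Fin.ext_iff]
  simp only [h1, h2, Finset.prod_ite_eq', Finset.mem_univ, if_true]
  exact mul_inv_cancel _

/-- The homomorphism `(t_1, …, t_s) ↦ diag(t_1, …, t_s, t⁻¹, 1, …, 1)` from `(K^*)^s` to `SL(m)`,
where `t = t_1 ⋯ t_s`. -/
def torusHom (K : Type*) [Field K] {m s : ℕ} (h : s < m) : (Fin s → Kˣ) →* SLm K m where
  toFun t := ⟨Matrix.diagonal fun a => (torusDiag t a : K), by
    rw [Matrix.det_diagonal, ← Units.coe_prod, prod_torusDiag h, Units.val_one]⟩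
  map_one' := by
    ext a b
    simp [torusDiag, Matrix.diagonal_apply, Matrix.one_apply]
  map_mul' t t' := by
    have key : ∀ a : Fin m, torusDiag (t * t') a = torusDiag t a * torusDiag t' a := by
      intro a
      unfold torusDiag
      split_ifs
      · rfl
      · simp [Finset.prod_mul_distrib, mul_comm]
      · simp
    apply Subtype.ext
    change Matrix.diagonal _ = Matrix.diagonal _ * Matrix.diagonal _
    rw [Matrix.diagonal_mul_diagonal]
    congr 1
    funext a
    rw [key, Units.val_mul]

/-- The subgroup `T'_F` of the matrices `diag(t_1, …, t_s, t⁻¹, 1, …, 1)`, viewed inside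
`N_G(F)`, `F` being the isotropy group of `(e_1, …, e_s)`. -/
def torusT' (K : Type*) [Field K] {m s : ℕ} (h : s < m) : Subgroup (NormGrp (stabF K h.le)) :=
  (torusHom K h).range.subgroupOf (NormGrp (stabF K h.le))

/-- The image `T_F` of `T'_F` in `N_G(F)/F`. -/
def torusT (K : Type*) [Field K] {m s : ℕ} (h : s < m) : Subgroup (NormQuot (stabF K h.le)) :=
  (torusT' K h).map (normProj (stabF K h.le))

/-- The pullback of the coordinate function `(v_1, …, v_s) ↦ (v_i)_a` along the orbit map
`g ↦ g · (e_1, …, e_s)`, as an element of `𝒪(G)^F`. -/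
def coordFun (K : Type*) [Field K] {m s : ℕ} (h : s ≤ m) (p : Fin s × Fin m) :
    invAlg (stabF K h) :=
  ⟨fun g => diagAct g (stdTuple K h) p.1 p.2, by
    have hE : (fun g : SLm K m => diagAct g (stdTuple K h) p.1 p.2)
        = fun g : SLm K m => g.1 p.2 (Fin.castLE h p.1) := by
      funext g
      simp [diagAct, stdTuple]
    refine ⟨?_, fun g k hk => ?_⟩
    · rw [hE]
      exact Algebra.subset_adjoin ⟨(p.2, Fin.castLE h p.1), rfl⟩
    · have h1 := congrFun (show diagAct k (stdTuple K h) = stdTuple K h from hk) p.1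
      simp only [diagAct] at h1 ⊢
      rw [Matrix.SpecialLinearGroup.coe_mul, ← Matrix.mulVec_mulVec, h1]⟩

/-- The map `Z → (K^m)^s` whose components are the coordinate functions. -/
def zCoord (K : Type*) [Field K] {m s : ℕ} (h : s ≤ m) (z : ZPt (stabF K h)) :
    Fin s → Fin m → K :=
  fun i a => z (coordFun K h (i, a))

end Example

/-! The orbit map `g ↦ g · (e_1, …, e_s)` reads off the first `s` columns of `g`, and its fibres are
the cosets of `F`. Everything rests on explicit local sections of it. Given `v = (v_1, …, v_s)`,
complete it to a square matrix by the last `m - s` columns of a fixed matrix `M`, and divide the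
column of index `s` by the determinant `d_M(v)`. Because `s < m`, that column exists and is not one
of the `v_i`, so the result (`slCols`) lies in `SL(m)` and lies over `v` wherever `d_M(v) ≠ 0`.

With `M = g` this is a section through `g`, so the orbit is open and `G/F` is isomorphic to it
(`isQuasiaffine_homogSpace_stabF`). Fixing `v` and varying `M` parametrizes `F` by an open subset of
affine space, so `F` is irreducible. An invariant function `f` becomes a fraction `P / d_M ^ k` on
each chart. Its reduced denominator divides a power of `d_M` for every invertible `M`. If column `s`
of `M` is supported in row `r`, then `d_M` contains no variable of row `r`; as `r` is arbitrary, the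
denominator is constant and `f` is a polynomial (`exists_polynomial_of_mem_invAlg`).

The normalizer is the block upper triangular group (`mem_normGrp_stabF_iff`), its upper left block
has kernel `F`, and the same section with `M = 1` inverts the block map. A torus containing `T_F` is
commutative, and a matrix commuting with all diagonal ones is diagonal, which gives maximality.
Finally `T_F` scales the coordinates of `v_i` by `t_i⁻¹`, so homogeneous polynomials consist of
monomials of one weight; evaluating at the 0/1 point with support `J` leaves exactly the monomials
in the variables of `J` (`exists_orbitCone_eq`). -/

/-! ### Function algebras: fractions, local sections, irreducibility by parametrization. -/

section FunctionAlgebras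

variable {K : Type*} [Field K]

/-- The functions of the form `p / d ^ k`, `p ∈ B`, on the locus where `d` does not vanish. -/
def fracAlg {X : Type*} (B : Subalgebra K (X → K)) (d : X → K) (hd : d ∈ B) :
    Subalgebra K (X → K) where
  carrier := {f | ∃ k : ℕ, ∃ p ∈ B, ∀ x, d x ≠ 0 → f x * d x ^ k = p x}
  mul_mem' := by
    rintro f g ⟨k, p, hp, h⟩ ⟨l, q, hq, h'⟩
    refine ⟨k + l, p * q, B.mul_mem hp hq, fun x hx => ?_⟩
    simp only [Pi.mul_apply, ← h x hx, ← h' x hx]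
    ring
  add_mem' := by
    rintro f g ⟨k, p, hp, h⟩ ⟨l, q, hq, h'⟩
    refine ⟨k + l, p * d ^ l + q * d ^ k, B.add_mem (B.mul_mem hp (B.pow_mem hd l))
      (B.mul_mem hq (B.pow_mem hd k)), fun x hx => ?_⟩
    simp only [Pi.mul_apply, Pi.add_apply, Pi.pow_apply, ← h x hx, ← h' x hx]
    ring
  algebraMap_mem' c := ⟨0, algebraMap K (X → K) c, B.algebraMap_mem c, fun x _ => by simp⟩

theorem le_fracAlg {X : Type*} {B : Subalgebra K (X → K)} {d : X → K} (hd : d ∈ B) :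
    B ≤ fracAlg B d hd :=
  fun f hf => ⟨0, f, hf, fun x _ => by simp⟩

theorem inv_mem_fracAlg {X : Type*} {B : Subalgebra K (X → K)} {d : X → K} (hd : d ∈ B) :
    (fun x => (d x)⁻¹) ∈ fracAlg B d hd :=
  ⟨1, 1, B.one_mem, fun x hx => by simp [hx]⟩

/-- Values where `d` vanishes are irrelevant, so the default value of `slCols` on that locus does no
harm. -/
theorem fracAlg_congr {X : Type*} {B : Subalgebra K (X → K)} {d : X → K} (hd : d ∈ B)
    {f g : X → K} (hf : f ∈ fracAlg B d hd) (hfg : ∀ x, d x ≠ 0 → f x = g x) :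
    g ∈ fracAlg B d hd := by
  obtain ⟨k, p, hp, h⟩ := hf
  exact ⟨k, p, hp, fun x hx => by rw [← hfg x hx, h x hx]⟩

theorem sum_fun_mem {X ι : Type*} (B : Subalgebra K (X → K)) (s : Finset ι) (f : ι → X → K)
    (hf : ∀ i ∈ s, f i ∈ B) : (fun x => ∑ i ∈ s, f i x) ∈ B := by
  have : (fun x => ∑ i ∈ s, f i x) = ∑ i ∈ s, f i := by
    funext x
    simp
  exact this ▸ B.sum_mem hf

theorem prod_fun_mem {X ι : Type*} (B : Subalgebra K (X → K)) (s : Finset ι) (f : ι → X → K)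
    (hf : ∀ i ∈ s, f i ∈ B) : (fun x => ∏ i ∈ s, f i x) ∈ B := by
  have : (fun x => ∏ i ∈ s, f i x) = ∏ i ∈ s, f i := by
    funext x
    simp
  exact this ▸ B.prod_mem hf

theorem det_fun_mem {X ι : Type*} [Fintype ι] [DecidableEq ι] (B : Subalgebra K (X → K))
    (M : X → Matrix ι ι K) (hM : ∀ i j, (fun x => M x i j) ∈ B) :
    (fun x => (M x).det) ∈ B := by
  simp only [Matrix.det_apply']
  refine sum_fun_mem B _ _ fun σ _ => B.mul_mem ?_ (prod_fun_mem B _ _ fun i _ => hM _ _)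
  exact B.algebraMap_mem (((Equiv.Perm.sign σ : ℤ) : K))

/-- A map that has local sections with entries in fractions of the target algebra identifies the
target with the quotient space with functions. -/
theorem ofAlg_iff_of_local_sections {G L : Type*} (A : Subalgebra K (G → K))
    (B : Subalgebra K (L → K)) (ψ : G → L) (hψ : ∀ b ∈ B, b ∘ ψ ∈ A)
    (hσ : ∀ x : L, ∃ (d : L → K) (hd : d ∈ B) (σ : L → G), d x ≠ 0 ∧
      (∀ y, d y ≠ 0 → ψ (σ y) = y) ∧ ∀ f ∈ A, f ∘ σ ∈ fracAlg B d hd) (V : Set L) :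
    ((SpaceWithFunctions.ofAlg B).top.IsOpen V ↔
      (SpaceWithFunctions.ofAlg A).top.IsOpen (ψ ⁻¹' V)) ∧
    ∀ f : L → K, f ∈ (SpaceWithFunctions.ofAlg B).reg V ↔
      f ∘ ψ ∈ (SpaceWithFunctions.ofAlg A).reg (ψ ⁻¹' V) := by
  refine ⟨⟨fun hV g hg => ?_, fun hV x hx => ?_⟩, fun f => ⟨fun hf g hg => ?_, fun hf x hx => ?_⟩⟩
  · obtain ⟨h, hB, hx, hh⟩ := hV (ψ g) hg
    exact ⟨h ∘ ψ, hψ h hB, hx, fun y hy => hh (ψ y) hy⟩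
  · obtain ⟨d, hd, σ, hdx, hs, hfr⟩ := hσ x
    obtain ⟨h, hA, hhx, hh⟩ := hV (σ x) (by rwa [Set.mem_preimage, hs x hdx])
    obtain ⟨k, p, hp, hpe⟩ := hfr h hA
    -- The extra factor `d` confines the basic open set to the locus where `σ` is a section; there
    -- `p` is `h ∘ σ` times a power of `d`.
    refine ⟨p * d, B.mul_mem hp hd, ?_, fun y hy => ?_⟩
    · rw [Pi.mul_apply, ← hpe x hdx]
      exact mul_ne_zero (mul_ne_zero hhx (pow_ne_zero _ hdx)) hdx
    · have hdy : d y ≠ 0 := right_ne_zero_of_mul hy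
      have hpy : p y ≠ 0 := left_ne_zero_of_mul hy
      rw [← hpe y hdy] at hpy
      have := hh (σ y) (left_ne_zero_of_mul hpy)
      rwa [Set.mem_preimage, hs y hdy] at this
  · obtain ⟨p, hp, q, hq, hqx, h⟩ := hf (ψ g) hg
    exact ⟨p ∘ ψ, hψ p hp, q ∘ ψ, hψ q hq, hqx, fun y hy hqy => h (ψ y) hy hqy⟩
  · obtain ⟨d, hd, σ, hdx, hs, hfr⟩ := hσ x
    obtain ⟨p, hp, q, hq, hqx, h⟩ := hf (σ x) (by rwa [Set.mem_preimage, hs x hdx])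
    obtain ⟨k, p', hp', hpe⟩ := hfr p hp
    obtain ⟨l, q', hq', hqe⟩ := hfr q hq
    -- On that locus `p ∘ σ = p' / d ^ k` and `q ∘ σ = q' / d ^ l`; clear denominators in the
    -- quotient.
    refine ⟨p' * d ^ l * d, B.mul_mem (B.mul_mem hp' (B.pow_mem hd l)) hd,
      q' * d ^ k * d, B.mul_mem (B.mul_mem hq' (B.pow_mem hd k)) hd, ?_, fun y hy hqy => ?_⟩
    · simp only [Pi.mul_apply, Pi.pow_apply, ← hqe x hdx]
      exact mul_ne_zero (mul_ne_zero (mul_ne_zero hqx (pow_ne_zero _ hdx))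
        (pow_ne_zero _ hdx)) hdx
    · have hdy : d y ≠ 0 := right_ne_zero_of_mul hqy
      have hqy' : q' y ≠ 0 := left_ne_zero_of_mul (left_ne_zero_of_mul hqy)
      rw [← hqe y hdy] at hqy'
      have hqs : q (σ y) ≠ 0 := left_ne_zero_of_mul hqy'
      have key := h (σ y) (by rwa [Set.mem_preimage, hs y hdy]) hqs
      simp only [Function.comp_apply, hs y hdy] at key hpe hqe
      simp only [Pi.mul_apply, Pi.pow_apply, ← hpe y hdy, ← hqe y hdy, key]
      field_simp

/-- The polynomial functions in variables indexed by `σ`. -/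
def polyFun (K : Type*) [Field K] (σ : Type*) : MvPolynomial σ K →ₐ[K] ((σ → K) → K) :=
  MvPolynomial.aeval fun (i : σ) (x : σ → K) => x i

theorem polyFun_apply {σ : Type*} (P : MvPolynomial σ K) (x : σ → K) :
    polyFun K σ P x = MvPolynomial.eval x P := by
  have : (Pi.evalAlgHom K (fun _ : σ → K => K) x).comp (polyFun K σ)
      = MvPolynomial.aeval x := by
    ext i
    simp [polyFun]
  simpa [MvPolynomial.aeval_eq_eval] using DFunLike.congr_fun this P

theorem coord_mem_polyFun {σ : Type*} (i : σ) :
    (fun x : σ → K => x i) ∈ (polyFun K σ).range :=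
  ⟨MvPolynomial.X i, by simp [polyFun]⟩

theorem exists_eval_of_mem_fracAlg {σ : Type*} {D : MvPolynomial σ K}
    {hD : polyFun K σ D ∈ (polyFun K σ).range} {f : (σ → K) → K}
    (hf : f ∈ fracAlg (polyFun K σ).range (polyFun K σ D) hD) :
    ∃ (k : ℕ) (P : MvPolynomial σ K), ∀ x, MvPolynomial.eval x D ≠ 0 →
      f x * MvPolynomial.eval x D ^ k = MvPolynomial.eval x P := by
  obtain ⟨k, p, ⟨P, rfl⟩, hP⟩ := hf
  refine ⟨k, P, fun x hx => ?_⟩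
  rw [← polyFun_apply, ← polyFun_apply]
  exact hP x (by rwa [polyFun_apply])

/-- The image of the complement of a hypersurface in affine space under a regular map is
irreducible. -/
theorem isPreirreducible_of_param [Infinite K] {G σ : Type*} (A : Subalgebra K (G → K))
    (F : Set G) (D : MvPolynomial σ K) (hD : D ≠ 0) (τ : (σ → K) → G)
    (hτF : ∀ x, MvPolynomial.eval x D ≠ 0 → τ x ∈ F)
    (hFτ : ∀ g ∈ F, ∃ x, MvPolynomial.eval x D ≠ 0 ∧ τ x = g)
    (hτ : ∀ f ∈ A, f ∘ τ ∈ fracAlg (polyFun K σ).range (polyFun K σ D) ⟨D, rfl⟩) :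
    @IsPreirreducible _ (zariski A) F := by
  rintro u v hu hv ⟨g, hgF, hgu⟩ ⟨g', hgF', hgv⟩
  obtain ⟨a, haA, hag, ha⟩ := hu g hgu
  obtain ⟨b, hbA, hbg, hb⟩ := hv g' hgv
  obtain ⟨x, hx, rfl⟩ := hFτ g hgF
  obtain ⟨x', hx', rfl⟩ := hFτ g' hgF'
  obtain ⟨k, P, hP⟩ := exists_eval_of_mem_fracAlg (hτ a haA)
  obtain ⟨l, Q, hQ⟩ := exists_eval_of_mem_fracAlg (hτ b hbA)
  simp only [Function.comp_apply] at hP hQ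
  have hP0 : P ≠ 0 := by
    rintro rfl
    simpa [hag, hx] using hP x hx
  have hQ0 : Q ≠ 0 := by
    rintro rfl
    simpa [hbg, hx'] using hQ x' hx'
  -- In parameter space both open sets contain nonvanishing loci of nonzero polynomials, and over an
  -- infinite field a nonzero product does not vanish identically.
  have hne : P * Q * D ≠ 0 := mul_ne_zero (mul_ne_zero hP0 hQ0) hD
  obtain ⟨y, hy⟩ : ∃ y, MvPolynomial.eval y (P * Q * D) ≠ 0 := by
    by_contra! hcon
    exact hne (MvPolynomial.funext fun y => by simpa using hcon y)
  simp only [map_mul] at hy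
  have hDy := right_ne_zero_of_mul hy
  have hPy := left_ne_zero_of_mul (left_ne_zero_of_mul hy)
  have hQy := right_ne_zero_of_mul (left_ne_zero_of_mul hy)
  rw [← hP y hDy] at hPy
  rw [← hQ y hDy] at hQy
  exact ⟨τ y, hτF y hDy, ha _ (left_ne_zero_of_mul hPy), hb _ (left_ne_zero_of_mul hQy)⟩

theorem isClosed_zariski_of_eqs {X ι : Type*} (A : Subalgebra K (X → K)) (S : Set X)
    (f : ι → X → K) (hf : ∀ i, f i ∈ A) (hS : ∀ x, x ∈ S ↔ ∀ i, f i x = 0) :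
    @IsClosed _ (zariski A) S := by
  refine @IsClosed.mk _ (zariski A) S fun x hx => ?_
  obtain ⟨i, hi⟩ : ∃ i, f i x ≠ 0 := by
    by_contra! hcon
    exact hx ((hS x).2 hcon)
  exact ⟨f i, hf i, hi, fun y hy hyS => hy ((hS y).1 hyS i)⟩

end FunctionAlgebras

/-! ### Completing `s` vectors to a matrix of determinant one. -/

section ColumnReplacement

variable {K : Type*} [Field K] {m s : ℕ}

/-- The matrix with first `s` columns `v_1, …, v_s` and the remaining ones those of `M`. -/
def replaceCols {R : Type*} (M : Matrix (Fin m) (Fin m) R) (v : Fin s → Fin m → R) :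
    Matrix (Fin m) (Fin m) R :=
  Matrix.of fun a b => if hb : (b : ℕ) < s then v ⟨b, hb⟩ a else M a b

/-- `replaceCols M v` with the column of index `s` divided by the determinant. -/
def normalizedCols (M : Matrix (Fin m) (Fin m) K) (v : Fin s → Fin m → K) :
    Matrix (Fin m) (Fin m) K :=
  Matrix.of fun a b =>
    (if (b : ℕ) = s then ((replaceCols M v).det)⁻¹ else 1) * replaceCols M v a b

/-- Here `s < m` is essential: the column of index `s` absorbs the factor, and exactly one column is
rescaled. -/
theorem det_normalizedCols (h : s < m) (M : Matrix (Fin m) (Fin m) K) (v : Fin s → Fin m → K)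
    (hd : (replaceCols M v).det ≠ 0) : (normalizedCols M v).det = 1 := by
  rw [normalizedCols, Matrix.det_mul_row]
  have : ∀ b : Fin m, (if (b : ℕ) = s then ((replaceCols M v).det)⁻¹ else 1)
      = if b = ⟨s, h⟩ then ((replaceCols M v).det)⁻¹ else 1 := by
    intro b
    simp [Fin.ext_iff]
  simp only [this, Finset.prod_ite_eq', Finset.mem_univ, if_true]
  exact inv_mul_cancel₀ hd

open Classical in
/-- `normalizedCols M v` as an element of `SL(m)`. -/
noncomputable def slCols (h : s < m) (M : Matrix (Fin m) (Fin m) K) (v : Fin s → Fin m → K) :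
    SLm K m :=
  if hd : (replaceCols M v).det ≠ 0 then ⟨normalizedCols M v, det_normalizedCols h M v hd⟩ else 1

theorem slCols_val (h : s < m) {M : Matrix (Fin m) (Fin m) K} {v : Fin s → Fin m → K}
    (hd : (replaceCols M v).det ≠ 0) : (slCols h M v).1 = normalizedCols M v := by
  have : slCols h M v = ⟨normalizedCols M v, det_normalizedCols h M v hd⟩ := dif_pos hd
  rw [this]

theorem diagAct_stdTuple (h : s ≤ m) (g : SLm K m) (i : Fin s) (a : Fin m) :
    diagAct g (stdTuple K h) i a = g.1 a (Fin.castLE h i) := by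
  simp [diagAct, stdTuple]

/-- The rescaled column comes after the first `s`, so these remain `v`: `slCols` is a section of the
orbit map. -/
theorem diagAct_slCols (h : s < m) {M : Matrix (Fin m) (Fin m) K} {v : Fin s → Fin m → K}
    (hd : (replaceCols M v).det ≠ 0) : diagAct (slCols h M v) (stdTuple K h.le) = v := by
  funext i a
  rw [diagAct_stdTuple, slCols_val h hd]
  simp [normalizedCols, replaceCols, i.2.ne]

theorem replaceCols_diagAct (h : s ≤ m) (g : SLm K m) :
    replaceCols g.1 (diagAct g (stdTuple K h)) = g.1 := by
  ext a b
  simp only [replaceCols, Matrix.of_apply, diagAct_stdTuple]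
  split_ifs <;> rfl

/-- Completing the columns of `g` by `g` itself gives determinant one, so nothing is rescaled. Hence
there is a local section through every point of the group. -/
theorem slCols_diagAct (h : s < m) (g : SLm K m) :
    slCols h g.1 (diagAct g (stdTuple K h.le)) = g := by
  have hd : (replaceCols g.1 (diagAct g (stdTuple K h.le))).det = 1 := by
    rw [replaceCols_diagAct, g.2]
  apply Subtype.ext
  rw [slCols_val h (by rw [hd]; exact one_ne_zero)]
  ext a b
  simp [normalizedCols, replaceCols_diagAct, g.2]

theorem replaceCols_mem {X : Type*} (B : Subalgebra K (X → K)) (M : X → Matrix (Fin m) (Fin m) K)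
    (v : X → Fin s → Fin m → K) (hM : ∀ a b, (fun x => M x a b) ∈ B)
    (hv : ∀ i a, (fun x => v x i a) ∈ B) (a b : Fin m) :
    (fun x => replaceCols (M x) (v x) a b) ∈ B := by
  simp only [replaceCols, Matrix.of_apply]
  split_ifs
  · exact hv _ _
  · exact hM _ _

theorem normalizedCols_mem {X : Type*} (B : Subalgebra K (X → K))
    (M : X → Matrix (Fin m) (Fin m) K)
    (v : X → Fin s → Fin m → K) (hM : ∀ a b, (fun x => M x a b) ∈ B)
    (hv : ∀ i a, (fun x => v x i a) ∈ B)
    (hd : (fun x => ((replaceCols (M x) (v x)).det)⁻¹) ∈ B) (a b : Fin m) :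
    (fun x => normalizedCols (M x) (v x) a b) ∈ B := by
  simp only [normalizedCols, Matrix.of_apply]
  split_ifs
  · exact B.mul_mem hd (replaceCols_mem B M v hM hv a b)
  · exact B.mul_mem B.one_mem (replaceCols_mem B M v hM hv a b)

theorem comp_mem_of_entries {X : Type*} (B : Subalgebra K (X → K)) (τ : X → SLm K m)
    (hτ : ∀ a b, (fun x => (τ x).1 a b) ∈ B) {f : SLm K m → K} (hf : f ∈ slAlg K m) :
    f ∘ τ ∈ B := by
  have key : slAlg K m ≤ B.comap (pullbackFun K τ) := by
    refine Algebra.adjoin_le ?_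
    rintro _ ⟨⟨a, b⟩, rfl⟩
    exact hτ a b
  exact key hf

theorem entry_mem_slAlg (a b : Fin m) : (fun g : SLm K m => g.1 a b) ∈ slAlg K m :=
  Algebra.subset_adjoin ⟨(a, b), rfl⟩

/-- Regular functions on `SL(m)` pull back under `slCols` to fractions whose denominators are
powers of the determinant. -/
theorem comp_slCols_mem {X : Type*} (h : s < m) (B : Subalgebra K (X → K))
    (M : X → Matrix (Fin m) (Fin m) K) (v : X → Fin s → Fin m → K)
    (hM : ∀ a b, (fun x => M x a b) ∈ B) (hv : ∀ i a, (fun x => v x i a) ∈ B)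
    {d : X → K} (hd : d ∈ B) (hdet : ∀ x, d x = (replaceCols (M x) (v x)).det)
    {f : SLm K m → K} (hf : f ∈ slAlg K m) :
    (f ∘ fun x => slCols h (M x) (v x)) ∈ fracAlg B d hd := by
  obtain rfl : d = fun x => (replaceCols (M x) (v x)).det := funext hdet
  refine comp_mem_of_entries _ _ (fun a b => ?_) hf
  refine fracAlg_congr hd (normalizedCols_mem (fracAlg B _ hd) M v
    (fun a b => le_fracAlg hd (hM a b)) (fun i a => le_fracAlg hd (hv i a))
    (inv_mem_fracAlg hd) a b) fun x hx => ?_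
  rw [slCols_val h hx]

end ColumnReplacement

/-! ### The isotropy group: block form, closedness, connectedness, quasiaffine quotient. -/

section IsotropyGroup

variable {K : Type*} [Field K] {m s : ℕ}

theorem eval_det_replaceCols {σ : Type*} (N : Matrix (Fin m) (Fin m) (MvPolynomial σ K))
    (w : Fin s → Fin m → MvPolynomial σ K) (x : σ → K) :
    MvPolynomial.eval x (replaceCols N w).det =
      (replaceCols (Matrix.of fun a b => MvPolynomial.eval x (N a b))
        fun i a => MvPolynomial.eval x (w i a)).det := by
  rw [RingHom.map_det]
  congr 1
  ext a b
  simp only [RingHom.mapMatrix_apply, Matrix.map_apply, replaceCols, Matrix.of_apply]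
  split_ifs <;> rfl

theorem diagAct_mul (g g' : SLm K m) (v : Fin s → Fin m → K) :
    diagAct (g * g') v = diagAct g (diagAct g' v) := by
  funext i
  simp only [diagAct]
  rw [Matrix.SpecialLinearGroup.coe_mul, ← Matrix.mulVec_mulVec]

theorem diagAct_one (v : Fin s → Fin m → K) : diagAct (1 : SLm K m) v = v := by
  funext i
  simp [diagAct]

theorem mem_stabF {h : s ≤ m} {g : SLm K m} :
    g ∈ stabF K h ↔ diagAct g (stdTuple K h) = stdTuple K h := Iff.rfl

/-- Identifies the coset relation with equality of orbit points; this makes the orbit map injective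
on `G/F` and lets invariant functions depend on the orbit point only. -/
theorem inv_mul_mem_stabF_iff {h : s ≤ m} {g g' : SLm K m} :
    g⁻¹ * g' ∈ stabF K h ↔ diagAct g (stdTuple K h) = diagAct g' (stdTuple K h) := by
  rw [mem_stabF, diagAct_mul]
  constructor
  · intro e
    conv_lhs => rw [← e]
    rw [← diagAct_mul, mul_inv_cancel, diagAct_one]
  · intro e
    rw [← e, ← diagAct_mul, inv_mul_cancel, diagAct_one]

theorem mem_stabF_iff_entries {h : s ≤ m} {g : SLm K m} :
    g ∈ stabF K h ↔ ∀ (i : Fin s) (a : Fin m),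
      g.1 a (Fin.castLE h i) = if a = Fin.castLE h i then 1 else 0 := by
  rw [mem_stabF, funext_iff]
  refine forall_congr' fun i => ?_
  rw [funext_iff]
  refine forall_congr' fun a => ?_
  rw [diagAct_stdTuple, stdTuple, Pi.single_apply]

theorem blockEquiv_inl (h : s ≤ m) (i : Fin s) : blockEquiv h (Sum.inl i) = Fin.castLE h i := by
  ext
  simp [blockEquiv]

theorem blockEquiv_inr_val (h : s ≤ m) (j : Fin (m - s)) :
    ((blockEquiv h (Sum.inr j) : Fin m) : ℕ) = s + j := by
  simp [blockEquiv]

theorem mem_stabF_iff_blocks (h : s ≤ m) (g : SLm K m) : g ∈ stabF K h ↔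
    ∃ (A : Matrix (Fin s) (Fin (m - s)) K) (B : Matrix.SpecialLinearGroup (Fin (m - s)) K),
      g.1 = Matrix.reindex (blockEquiv h) (blockEquiv h) (Matrix.fromBlocks 1 A 0 B.1) := by
  constructor
  · intro hg
    rw [mem_stabF_iff_entries] at hg
    set g' := Matrix.reindex (blockEquiv h).symm (blockEquiv h).symm g.1 with hg'
    have h1 : g'.toBlocks₁₁ = 1 := by
      ext i j
      simp [hg', Matrix.toBlocks₁₁, blockEquiv_inl, hg, Matrix.one_apply]
    have h2 : g'.toBlocks₂₁ = 0 := by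
      ext i j
      simp only [hg', Matrix.toBlocks₂₁, Matrix.reindex_apply, Equiv.symm_symm, blockEquiv_inl,
        Matrix.submatrix_apply, Matrix.of_apply, hg, Matrix.zero_apply, ite_eq_right_iff]
      intro e
      have := congrArg Fin.val e
      simp only [blockEquiv_inr_val, Fin.val_castLE] at this
      omega
    have h3 : g' = Matrix.fromBlocks 1 g'.toBlocks₁₂ 0 g'.toBlocks₂₂ := by
      conv_lhs => rw [← Matrix.fromBlocks_toBlocks g', h1, h2]
    have h4 : g'.toBlocks₂₂.det = 1 := by
      have : g'.det = 1 := by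
        rw [hg', Matrix.det_reindex_self, g.2]
      rw [h3, Matrix.det_fromBlocks_zero₂₁, Matrix.det_one, one_mul] at this
      exact this
    refine ⟨g'.toBlocks₁₂, ⟨g'.toBlocks₂₂, h4⟩, ?_⟩
    change g.1 = Matrix.reindex _ _ (Matrix.fromBlocks 1 g'.toBlocks₁₂ 0 g'.toBlocks₂₂)
    rw [← h3, hg']
    ext a b
    simp
  · rintro ⟨A, B, hg⟩
    rw [mem_stabF_iff_entries]
    intro i a
    obtain ⟨c, rfl⟩ := (blockEquiv h).surjective a
    rw [hg, ← blockEquiv_inl]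
    simp only [Matrix.reindex_apply, Matrix.submatrix_apply, Equiv.symm_apply_apply,
      (blockEquiv h).injective.eq_iff]
    rcases c with c | c <;> simp [Matrix.one_apply]

theorem isClosed_stabF (h : s ≤ m) :
    @IsClosed _ (zariski (slAlg K m)) (stabF K h : Set (SLm K m)) := by
  refine isClosed_zariski_of_eqs (ι := Fin s × Fin m) _ _
    (fun p g => g.1 p.2 (Fin.castLE h p.1) - if p.2 = Fin.castLE h p.1 then 1 else 0)
    (fun p => ?_) fun g => ?_
  · exact Subalgebra.sub_mem _ (entry_mem_slAlg _ _) (Subalgebra.algebraMap_mem _ _)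
  · simp only [SetLike.mem_coe, mem_stabF_iff_entries, sub_eq_zero, Prod.forall]

/-- The first `s` columns are fixed to be the standard tuple while `M` runs through all square
matrices with `D ≠ 0`; an element of `F` is its own parameter. So `F` is irreducible, being a
regular image of an open subset of affine space. -/
theorem isZariskiConnected_stabF [Infinite K] (h : s < m) :
    IsZariskiConnected (stabF K h.le) := by
  refine ⟨⟨1, (stabF K h.le).one_mem⟩, ?_⟩
  let e : Fin s → Fin m → K := stdTuple K h.le
  let N : (Fin m × Fin m → K) → Matrix (Fin m) (Fin m) K := fun x => Matrix.of fun a b => x (a, b)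
  let D : MvPolynomial (Fin m × Fin m) K :=
    (replaceCols (Matrix.of fun a b => MvPolynomial.X (a, b))
      fun i a => MvPolynomial.C (e i a)).det
  have hD : ∀ x, MvPolynomial.eval x D = (replaceCols (N x) e).det := by
    intro x
    simp only [D, eval_det_replaceCols, Matrix.of_apply, MvPolynomial.eval_X, MvPolynomial.eval_C]
    rfl
  have hg : ∀ g ∈ stabF K h.le, MvPolynomial.eval (fun p => g.1 p.1 p.2) D = 1 := by
    intro g hg
    rw [hD]
    conv_lhs => rw [show e = diagAct g e from hg.symm]
    exact (congrArg Matrix.det (replaceCols_diagAct h.le g)).trans g.2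
  refine @IsPreirreducible.isPreconnected _ (zariski (slAlg K m)) _
    (isPreirreducible_of_param _ _ D ?_ (fun x => slCols h (N x) e) ?_ ?_ ?_)
  · intro h0
    simpa [h0] using hg 1 (Subgroup.one_mem _)
  · intro x hx
    rw [hD] at hx
    exact diagAct_slCols h hx
  · intro g hgF
    refine ⟨fun p => g.1 p.1 p.2, by rw [hg g hgF]; exact one_ne_zero, ?_⟩
    conv_lhs => rw [show e = diagAct g e from hgF.symm]
    exact slCols_diagAct h g
  · intro f hf
    refine comp_slCols_mem h _ N (fun _ => e) (fun a b => coord_mem_polyFun (a, b))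
      (fun i a => Subalgebra.algebraMap_mem _ (e i a)) _ (fun x => ?_) hf
    rw [polyFun_apply, hD]

/-- The orbit `L` is open: near the orbit point of `g`, the determinant completed by the columns of
`g` is nonzero, and every tuple where it is nonzero is hit by `slCols`. The same sections identify
the quotient structure on `G/F` with that of `L`. -/
theorem isQuasiaffine_homogSpace_stabF (h : s < m) :
    (homogSpace (stabF K h.le)).IsQuasiaffine := by
  -- Affine space is indexed by a single `Fin n`, so tuples of vectors are flattened; `c` restores
  -- them.
  let c : (Fin (s * m) → K) → Fin s → Fin m → K := fun w i a => w (finProdFinEquiv (i, a))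
  have hc : ∀ {w w'}, c w = c w' → w = w' := by
    intro w w' e
    funext p
    obtain ⟨⟨i, a⟩, rfl⟩ := finProdFinEquiv.surjective p
    exact congrFun (congrFun e i) a
  let ψ₀ : SLm K m → Fin (s * m) → K := fun g p =>
    diagAct g (stdTuple K h.le) (finProdFinEquiv.symm p).1 (finProdFinEquiv.symm p).2
  have hcψ : ∀ g, c (ψ₀ g) = diagAct g (stdTuple K h.le) := by
    intro g
    funext i a
    simp only [c, ψ₀, Equiv.symm_apply_apply]
  let L : Set (Fin (s * m) → K) := Set.range ψ₀
  let ψ : SLm K m → L := fun g => ⟨ψ₀ g, g, rfl⟩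
  have hψ : ∀ g g', ψ g = ψ g' ↔ g⁻¹ * g' ∈ stabF K h.le := by
    intro g g'
    rw [inv_mul_mem_stabF_iff, ← hcψ, ← hcψ]
    exact ⟨fun e => congrArg c (congrArg Subtype.val e), fun e => Subtype.ext (hc e)⟩
  let dfun : SLm K m → (Fin (s * m) → K) → K := fun g w => (replaceCols g.1 (c w)).det
  have hdmem : ∀ g, dfun g ∈ polyAlg K (s * m) := by
    intro g
    refine det_fun_mem _ _ fun a b => replaceCols_mem _ (fun _ => g.1) c (fun a b => ?_)
      (fun i a => ?_) a b
    · exact Subalgebra.algebraMap_mem _ _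
    · exact Algebra.subset_adjoin ⟨_, rfl⟩
  have hd1 : ∀ g, dfun g (ψ₀ g) ≠ 0 := by
    intro g
    simp only [dfun, hcψ, replaceCols_diagAct, g.2]
    exact one_ne_zero
  have hsec : ∀ g w, dfun g w ≠ 0 → ψ₀ (slCols h g.1 (c w)) = w := fun g w hw =>
    hc ((hcψ _).trans (diagAct_slCols h hw))
  have hL : (zariski (polyAlg K (s * m))).IsOpen L := by
    rintro _ ⟨g, rfl⟩
    exact ⟨dfun g, hdmem g, hd1 g, fun w hw => ⟨_, hsec g w hw⟩⟩
  have key := ofAlg_iff_of_local_sections (slAlg K m) (restrictAlg (polyAlg K (s * m)) L) ψ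
    (by
      rintro _ ⟨p, hp, rfl⟩
      have : polyAlg K (s * m) ≤ (slAlg K m).comap (pullbackFun K ψ₀) := by
        refine Algebra.adjoin_le ?_
        rintro _ ⟨q, rfl⟩
        change (fun g => ψ₀ g q) ∈ slAlg K m
        simp only [ψ₀, diagAct_stdTuple]
        exact entry_mem_slAlg _ _
      exact this hp)
    (by
      rintro ⟨_, g, rfl⟩
      have hr : ∀ p ∈ polyAlg K (s * m),
          (fun x : L => p x) ∈ restrictAlg (polyAlg K (s * m)) L := fun p hp => ⟨p, hp, rfl⟩
      refine ⟨fun x => dfun g x, hr _ (hdmem g), fun x => slCols h g.1 (c x), hd1 g,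
        fun y hy => Subtype.ext (hsec g y hy), fun f hf => ?_⟩
      exact comp_slCols_mem h _ (fun _ => g.1) (fun x : L => c x)
        (fun a b => Subalgebra.algebraMap_mem _ _)
        (fun i a => hr _ (Algebra.subset_adjoin ⟨finProdFinEquiv (i, a), rfl⟩))
        (hr _ (hdmem g)) (fun x => rfl) hf)
  refine ⟨s * m, L, @IsOpen.isLocallyClosed _ L (zariski (polyAlg K (s * m))) hL,
    Quotient.lift ψ fun g g' e => (hψ g g').2 (QuotientGroup.leftRel_apply.1 e), ⟨?_, ?_⟩, ?_, ?_⟩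
  · rintro ⟨g⟩ ⟨g'⟩ e
    exact QuotientGroup.eq.2 ((hψ g g').1 e)
  · rintro ⟨_, g, rfl⟩
    exact ⟨QuotientGroup.mk g, rfl⟩
  · exact fun V => (key V).1
  · exact fun V _ f => (key V).2 f

end IsotropyGroup

/-! ### The invariant ring is the polynomial ring in the first `s` columns. -/

section InvariantRing

variable {K : Type*} [Field K] {m s : ℕ}

/-- The determinant of the matrix whose first `s` columns are generic and whose remaining columns
are those of `M`. -/
noncomputable def detPoly (s : ℕ) (M : Matrix (Fin m) (Fin m) K) : MvPolynomial (Fin s × Fin m) K :=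
  (replaceCols (Matrix.of fun a b => MvPolynomial.C (M a b))
    fun i a => MvPolynomial.X (i, a)).det

theorem eval_detPoly (M : Matrix (Fin m) (Fin m) K) (x : Fin s × Fin m → K) :
    MvPolynomial.eval x (detPoly s M) = (replaceCols M fun i a => x (i, a)).det := by
  simp only [detPoly, eval_det_replaceCols, Matrix.of_apply, MvPolynomial.eval_X,
    MvPolynomial.eval_C]
  rfl

/-- Substituting the first `s` columns of `M` for the variables gives back `M.det`. -/
theorem detPoly_ne_zero (h : s ≤ m) (M : Matrix (Fin m) (Fin m) K) (hM : M.det ≠ 0) :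
    detPoly s M ≠ 0 := by
  intro h0
  have := eval_detPoly M fun p : Fin s × Fin m => M p.2 (Fin.castLE h p.1)
  rw [h0, map_zero] at this
  refine hM (Eq.trans ?_ this.symm)
  congr 1
  ext a b
  simp only [replaceCols, Matrix.of_apply]
  split_ifs <;> rfl

/-- If the column of index `s` of `M` is concentrated in row `r`, then the variables of row `r`
do not occur in `detPoly s M`. -/
theorem degreeOf_detPoly (h : s < m) (M : Matrix (Fin m) (Fin m) K) (r : Fin m)
    (hM : ∀ a, a ≠ r → M a ⟨s, h⟩ = 0) (i : Fin s) : (detPoly s M).degreeOf (i, r) = 0 := by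
  have key : detPoly s M ∈ MvPolynomial.supported K {p : Fin s × Fin m | p.2 ≠ r} := by
    rw [detPoly, Matrix.det_apply]
    refine Subalgebra.sum_mem _ fun σ _ => ?_
    rw [Units.smul_def]
    refine Subalgebra.zsmul_mem _ ?_ _
    -- A Leibniz term survives only if it takes its entry of column `s` from row `r`; its remaining
    -- factors then avoid row `r`.
    by_cases hσ : σ ⟨s, h⟩ = r
    · refine Subalgebra.prod_mem _ fun b _ => ?_
      simp only [replaceCols, Matrix.of_apply]
      split_ifs with hb
      · refine MvPolynomial.X_mem_supported.2 fun e => ?_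
        have : b = ⟨s, h⟩ := σ.injective (e.trans hσ.symm)
        rw [this] at hb
        exact lt_irrefl _ hb
      · exact Subalgebra.algebraMap_mem _ _
    · rw [Finset.prod_eq_zero (Finset.mem_univ (⟨s, h⟩ : Fin m))]
      · exact Subalgebra.zero_mem _
      · simp [replaceCols, hM _ hσ]
  rw [MvPolynomial.mem_supported] at key
  by_contra hne
  exact key (Finset.mem_coe.2 (MvPolynomial.mem_vars_iff_degreeOf_ne_zero.2 hne)) rfl

/-- A transposition matrix suffices. With `c` the column of index `s`, it supplies for each row an
admissible denominator without variables of that row. -/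
theorem exists_matrix_col_concentrated (c r : Fin m) :
    ∃ M : Matrix (Fin m) (Fin m) K, M.det ≠ 0 ∧ ∀ a, a ≠ r → M a c = 0 := by
  refine ⟨(Equiv.swap r c).permMatrix K, ?_, fun a ha => ?_⟩
  · rw [Matrix.det_permutation]
    rcases Int.units_eq_one_or (Equiv.Perm.sign (Equiv.swap r c)) with e | e <;> simp [e]
  · have : Equiv.swap r c a ≠ c := fun e => ha <| by
      rwa [Equiv.swap_apply_eq_iff, Equiv.swap_apply_right] at e
    simp [Equiv.Perm.permMatrix, PEquiv.toMatrix_apply, this]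

/-- Degrees in one variable add under multiplication over a domain, so a divisor of `d ^ k` involves
only variables of `d`. -/
theorem degreeOf_eq_zero_of_dvd_pow {σ : Type*} {b d : MvPolynomial σ K} {k : ℕ} (hd : d ≠ 0)
    (hbd : b ∣ d ^ k) {i : σ} (hi : d.degreeOf i = 0) : b.degreeOf i = 0 := by
  obtain ⟨q, hq⟩ := hbd
  have hne : b * q ≠ 0 := hq ▸ pow_ne_zero k hd
  have h1 := MvPolynomial.degreeOf_pow_le i d k
  rw [hq, MvPolynomial.degreeOf_mul_eq (left_ne_zero_of_mul hne) (right_ne_zero_of_mul hne),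
    hi] at h1
  omega

theorem mvPolynomial_eq_zero_of_eval [Infinite K] {σ : Type*} {P d : MvPolynomial σ K}
    (hd : d ≠ 0) (hP : ∀ x, MvPolynomial.eval x d ≠ 0 → MvPolynomial.eval x P = 0) : P = 0 := by
  have : P * d = 0 := MvPolynomial.funext fun x => by
    by_cases hx : MvPolynomial.eval x d = 0
    · simp [hx]
    · simp [hP x hx]
  exact (mul_eq_zero.1 this).resolve_right hd

theorem apply_eq_of_diagAct_eq {h : s ≤ m} {f : SLm K m → K} (hf : f ∈ invAlg (stabF K h))
    {g g' : SLm K m} (e : diagAct g (stdTuple K h) = diagAct g' (stdTuple K h)) : f g = f g' := by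
  have := hf.2 g (g⁻¹ * g') (inv_mul_mem_stabF_iff.2 e)
  rw [← this, mul_inv_cancel_left]

/-- An `F`-invariant regular function on `SL(m)` is a polynomial in the first `s` columns. -/
theorem exists_polynomial_of_mem_invAlg [Infinite K] (h : s < m) {f : SLm K m → K}
    (hf : f ∈ invAlg (stabF K h.le)) : ∃ Q : MvPolynomial (Fin s × Fin m) K,
      ∀ g, f g = MvPolynomial.eval (fun p => diagAct g (stdTuple K h.le) p.1 p.2) Q := by
  have hloc : ∀ M : Matrix (Fin m) (Fin m) K, ∃ (k : ℕ) (P : MvPolynomial (Fin s × Fin m) K),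
      ∀ x, MvPolynomial.eval x (detPoly s M) ≠ 0 →
        f (slCols h M fun i a => x (i, a)) * MvPolynomial.eval x (detPoly s M) ^ k
          = MvPolynomial.eval x P := by
    intro M
    refine exists_eval_of_mem_fracAlg (hD := ⟨_, rfl⟩) ?_
    refine comp_slCols_mem h _ (fun _ => M) (fun (x : Fin s × Fin m → K) i a => x (i, a))
      (fun a b => Subalgebra.algebraMap_mem _ (M a b)) (fun i a => coord_mem_polyFun (i, a)) _
      (fun x => ?_) hf.1
    rw [polyFun_apply, eval_detPoly]
  obtain ⟨k₁, P₁, h₁⟩ := hloc 1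
  have hd₁ : detPoly s (1 : Matrix (Fin m) (Fin m) K) ≠ 0 :=
    detPoly_ne_zero h.le _ (by rw [Matrix.det_one]; exact one_ne_zero)
  -- Write `P₁ / d₁ ^ k₁`, the expression of `f` on the chart of the identity matrix, as a reduced
  -- fraction `a / b`.
  obtain ⟨a, b, c, hab, hca, hcb⟩ := UniqueFactorizationMonoid.exists_reduced_factors' P₁ _
    (pow_ne_zero k₁ hd₁)
  have hcb0 : c * b ≠ 0 := hcb ▸ pow_ne_zero k₁ hd₁
  -- Two sections over the same point differ by an element of `F`, so the invariant `f` agrees on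
  -- them; hence `a / b = P / d_M ^ k` where both charts are defined, and therefore as polynomials
  -- after cross-multiplying.
  have hcross : ∀ (M : Matrix (Fin m) (Fin m) K) (k : ℕ) (P : MvPolynomial (Fin s × Fin m) K),
      M.det ≠ 0 → (∀ x, MvPolynomial.eval x (detPoly s M) ≠ 0 →
        f (slCols h M fun i a => x (i, a)) * MvPolynomial.eval x (detPoly s M) ^ k
          = MvPolynomial.eval x P) → a * detPoly s M ^ k = b * P := by
    intro M k P hM hP
    have hd := detPoly_ne_zero h.le M hM
    rw [← sub_eq_zero]
    refine mvPolynomial_eq_zero_of_eval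
      (mul_ne_zero (mul_ne_zero (left_ne_zero_of_mul hcb0) hd₁) hd) fun x hx => ?_
    simp only [map_mul] at hx
    have hx3 := right_ne_zero_of_mul hx
    have hx2 := right_ne_zero_of_mul (left_ne_zero_of_mul hx)
    have hx1 := left_ne_zero_of_mul (left_ne_zero_of_mul hx)
    have e₁ := h₁ x hx2
    have e₂ := hP x hx3
    have hφ : f (slCols h M fun i a => x (i, a)) = f (slCols h 1 fun i a => x (i, a)) := by
      refine apply_eq_of_diagAct_eq hf ?_
      rw [eval_detPoly] at hx2 hx3
      rw [diagAct_slCols h hx2, diagAct_slCols h hx3]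
    have e₃ := congrArg (MvPolynomial.eval x) hca
    have e₄ := congrArg (MvPolynomial.eval x) hcb
    simp only [map_mul, map_pow, map_sub] at e₃ e₄ ⊢
    rw [hφ] at e₂
    apply mul_left_cancel₀ hx1
    rw [mul_zero, mul_sub, ← mul_assoc, ← mul_assoc, e₃, e₄, ← e₁, ← e₂]
    ring
  -- Since `a` and `b` are coprime, `b` divides `d_M ^ k` for every invertible `M`; a choice of `M`
  -- adapted to row `r` excludes the variables of that row.
  have hb : b.vars = ∅ := by
    refine Finset.eq_empty_of_forall_notMem ?_
    rintro ⟨i, r⟩ hir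
    rw [MvPolynomial.mem_vars_iff_degreeOf_ne_zero] at hir
    obtain ⟨M, hM, hMr⟩ := exists_matrix_col_concentrated (K := K) ⟨s, h⟩ r
    obtain ⟨k, P, hP⟩ := hloc M
    have hdvd : b ∣ detPoly s M ^ k :=
      hab.symm.dvd_of_dvd_mul_left ⟨P, hcross M k P hM hP⟩
    exact hir (degreeOf_eq_zero_of_dvd_pow (detPoly_ne_zero h.le M hM) hdvd
      (degreeOf_detPoly h M r hMr i))
  rw [MvPolynomial.vars_eq_empty_iff_eq_C] at hb
  set β := MvPolynomial.coeff 0 b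
  have hβ : β ≠ 0 := by
    intro h0
    rw [h0, map_zero] at hb
    exact right_ne_zero_of_mul hcb0 hb
  refine ⟨MvPolynomial.C β⁻¹ * a, fun g => ?_⟩
  -- With `M = g` the denominator equals `1` at the orbit point of `g`, so the cross relation can be
  -- evaluated there directly.
  obtain ⟨k, P, hP⟩ := hloc g.1
  have e₁ := congrArg (MvPolynomial.eval fun p => diagAct g (stdTuple K h.le) p.1 p.2)
    (hcross g.1 k P (by rw [g.2]; exact one_ne_zero) hP)
  have hd : MvPolynomial.eval (fun p => diagAct g (stdTuple K h.le) p.1 p.2) (detPoly s g.1) = 1 := by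
    rw [eval_detPoly, replaceCols_diagAct, g.2]
  have e₂ := hP _ (by rw [hd]; exact one_ne_zero)
  rw [hd, one_pow, mul_one, slCols_diagAct] at e₂
  rw [map_mul, map_mul, map_pow, hd, one_pow, mul_one, hb, MvPolynomial.eval_C, ← e₂] at e₁
  rw [map_mul, MvPolynomial.eval_C, e₁, inv_mul_cancel_left₀ hβ]

theorem aeval_coordFun_apply (h : s ≤ m) (Q : MvPolynomial (Fin s × Fin m) K) (g : SLm K m) :
    (MvPolynomial.aeval (coordFun K h) Q : invAlg (stabF K h)).1 g
      = MvPolynomial.eval (fun p => diagAct g (stdTuple K h) p.1 p.2) Q := by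
  have : (ZPt.ofGroup (stabF K h) g).comp (MvPolynomial.aeval (coordFun K h))
      = MvPolynomial.aeval fun p => diagAct g (stdTuple K h) p.1 p.2 := by
    ext p
    simp only [AlgHom.comp_apply, MvPolynomial.aeval_X]
    rfl
  exact DFunLike.congr_fun this Q

/-- Injectivity holds because the orbit contains the nonvanishing locus of `detPoly s 1`, on which
only the zero polynomial vanishes identically. -/
theorem bijective_aeval_coordFun [Infinite K] (h : s < m) : Function.Bijective
    (MvPolynomial.aeval (coordFun K h.le) :
      MvPolynomial (Fin s × Fin m) K →ₐ[K] invAlg (stabF K h.le)) := by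
  constructor
  · refine (injective_iff_map_eq_zero _).2 fun Q hQ => ?_
    refine mvPolynomial_eq_zero_of_eval (d := detPoly s 1)
      (detPoly_ne_zero h.le _ (by rw [Matrix.det_one]; exact one_ne_zero)) fun x hx => ?_
    rw [eval_detPoly] at hx
    have := aeval_coordFun_apply h.le Q (slCols h 1 fun i a => x (i, a))
    rw [hQ, diagAct_slCols h hx] at this
    exact this.symm
  · rintro ⟨f, hf⟩
    obtain ⟨Q, hQ⟩ := exists_polynomial_of_mem_invAlg h hf
    refine ⟨Q, Subtype.ext (funext fun g => ?_)⟩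
    rw [aeval_coordFun_apply]
    exact (hQ g).symm

theorem adjoin_range_coordFun [Infinite K] (h : s < m) :
    Algebra.adjoin K (Set.range (coordFun K h.le)) = ⊤ := by
  rw [Algebra.adjoin_range_eq_range_aeval, AlgHom.range_eq_top]
  exact (bijective_aeval_coordFun h).2

theorem isGrosshans_stabF [Infinite K] (h : s < m) : IsGrosshans (stabF K h.le) := by
  refine ⟨⟨isClosed_stabF h.le, isQuasiaffine_homogSpace_stabF h⟩, ?_⟩
  rw [← Subalgebra.fg_top]
  exact Subalgebra.fg_def.2 ⟨_, Set.finite_range _, adjoin_range_coordFun h⟩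

end InvariantRing

/-! ### The normalizer of `F` and the isomorphism of its quotient with `GL(s)`. -/

section Normalizer

variable {K : Type*} [Field K] {m s : ℕ}

/-- The matrices `n` with `n_{ai} = 0` for `i < s ≤ a`. -/
def IsBlockUpper (s : ℕ) (M : Matrix (Fin m) (Fin m) K) : Prop :=
  ∀ a b : Fin m, (b : ℕ) < s → s ≤ (a : ℕ) → M a b = 0

/-- Block triangularity for the two-valued labelling `β`, which is inherited by inverses. -/
theorem IsBlockUpper.inv {n : SLm K m} (hn : IsBlockUpper s n.1) : IsBlockUpper s (n⁻¹).1 := by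
  let β : Fin m → ℕ := fun a => if (a : ℕ) < s then 0 else 1
  have hβ : ∀ {M : Matrix (Fin m) (Fin m) K}, IsBlockUpper s M ↔ M.BlockTriangular β := by
    intro M
    refine ⟨fun hM a b hab => ?_, fun hM a b hb ha => hM ?_⟩
    · simp only [β] at hab
      split_ifs at hab with h1 h2
      · omega
      · exact hM a b h1 (not_lt.1 h2)
      · omega
      · omega
    · simp [β, hb, not_lt.2 ha]
  have hdet : IsUnit n.1.det := by
    rw [n.2]
    exact isUnit_one
  let := n.1.invertibleOfIsUnitDet hdet
  have hinv : (n⁻¹).1 = n.1⁻¹ := by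
    rw [Matrix.inv_def, n.2, Ring.inverse_one, one_smul]
    exact Matrix.SpecialLinearGroup.coe_inv n
  rw [hβ, hinv]
  exact Matrix.blockTriangular_inv_of_blockTriangular (hβ.1 hn)

/-- Such an `n` sends each `e_i`, `i` among the first `s`, into the span of these vectors, where `f`
acts trivially; so `f n e_i = n e_i`. -/
theorem IsBlockUpper.conj_mem_stabF {h : s ≤ m} {n f : SLm K m} (hn : IsBlockUpper s n.1)
    (hf : f ∈ stabF K h) : n⁻¹ * f * n ∈ stabF K h := by
  rw [mul_assoc, inv_mul_mem_stabF_iff]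
  funext i a
  rw [mem_stabF_iff_entries] at hf
  rw [diagAct_stdTuple, diagAct_stdTuple, Matrix.SpecialLinearGroup.coe_mul, Matrix.mul_apply]
  rw [Finset.sum_eq_single a]
  · by_cases ha : (a : ℕ) < s
    · have := hf ⟨a, ha⟩ a
      rw [if_pos (by ext; rfl)] at this
      rw [show f.1 a a = 1 from this, one_mul]
    · rw [hn a _ i.2 (not_lt.1 ha), mul_zero]
  · intro b _ hb
    by_cases hbs : (b : ℕ) < s
    · have := hf ⟨b, hbs⟩ a
      rw [if_neg fun e => hb (e.trans (by ext; rfl)).symm] at this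
      rw [show f.1 a b = 0 from this, zero_mul]
    · rw [hn b _ i.2 (not_lt.1 hbs), mul_zero]
  · intro ha
    exact absurd (Finset.mem_univ a) ha

theorem mem_normGrp_stabF_iff {h : s ≤ m} {n : SLm K m} :
    n ∈ NormGrp (stabF K h) ↔ IsBlockUpper s n.1 := by
  constructor
  · intro hn a b hb ha
    obtain ⟨i, rfl⟩ : ∃ i : Fin s, b = Fin.castLE h i := ⟨⟨b, hb⟩, by ext; rfl⟩
    have hne : Fin.castLE h i ≠ a := by
      intro e
      have := congrArg Fin.val e
      simp only [Fin.val_castLE] at this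
      omega
    -- This transvection lies in `F`. If its conjugate fixes `e_i`, then `g n e_i = n e_i`, and row
    -- `i` of this equation reads `n_ii + n_ai = n_ii`.
    let g : SLm K m := ⟨Matrix.transvection (Fin.castLE h i) a 1,
      Matrix.det_transvection_of_ne _ _ hne 1⟩
    have hg : g ∈ stabF K h := by
      rw [mem_stabF_iff_entries]
      intro j c
      have hj : a ≠ Fin.castLE h j := by
        intro e
        have := congrArg Fin.val e
        simp only [Fin.val_castLE] at this
        omega
      simp [g, Matrix.transvection, Matrix.one_apply, hj]
    have h1 := (Subgroup.mem_normalizer_iff''.1 hn g).1 hg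
    rw [mul_assoc] at h1
    have h2 := congrFun (congrFun (inv_mul_mem_stabF_iff.1 h1) i) (Fin.castLE h i)
    rw [diagAct_stdTuple, diagAct_stdTuple, Matrix.SpecialLinearGroup.coe_mul] at h2
    simp only [g, Matrix.transvection_mul_apply_same, one_mul] at h2
    exact add_eq_left.1 h2.symm
  · intro hn
    refine Subgroup.mem_normalizer_iff''.2 fun f => ⟨fun hf => hn.conj_mem_stabF hf, fun hf => ?_⟩
    have := hn.inv.conj_mem_stabF (h := h) hf
    rwa [show n⁻¹⁻¹ * (n⁻¹ * f * n) * n⁻¹ = f by group] at this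

/-- The upper left `s × s` block, as a multiplicative map from the normalizer to matrices. -/
def topBlock (h : s ≤ m) : NormGrp (stabF K h) →* Matrix (Fin s) (Fin s) K where
  toFun n := n.1.1.submatrix (Fin.castLE h) (Fin.castLE h)
  map_one' := by
    ext i j
    simp [Matrix.one_apply]
  map_mul' n n' := by
    ext i j
    simp only [Subgroup.coe_mul, Matrix.SpecialLinearGroup.coe_mul, Matrix.submatrix_apply,
      Matrix.mul_apply]
    rw [← (blockEquiv h).sum_comp, Fintype.sum_sum_type]
    simp only [blockEquiv_inl]
    refine add_eq_left.2 (Finset.sum_eq_zero fun k _ => ?_)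
    rw [mem_normGrp_stabF_iff.1 n'.2 _ _ j.2 (by rw [blockEquiv_inr_val]; omega), mul_zero]

/-- The upper left `s × s` block, as a homomorphism from the normalizer to `GL(s)`. -/
def topBlockHom (h : s ≤ m) :
    NormGrp (stabF K h) →* Matrix.GeneralLinearGroup (Fin s) K :=
  MonoidHom.toHomUnits (topBlock h)

theorem topBlockHom_apply (h : s ≤ m) (n : NormGrp (stabF K h)) (i j : Fin s) :
    (topBlockHom h n).1 i j = n.1.1 (Fin.castLE h i) (Fin.castLE h j) := rfl

theorem topBlockHom_eq_one_iff (h : s ≤ m) (n : NormGrp (stabF K h)) :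
    topBlockHom h n = 1 ↔ (n : SLm K m) ∈ stabF K h := by
  rw [mem_stabF_iff_entries]
  constructor
  · intro e i a
    by_cases ha : (a : ℕ) < s
    · have e' := congrArg (fun P : Matrix.GeneralLinearGroup (Fin s) K => P.1 ⟨a, ha⟩ i) e
      rw [topBlockHom_apply] at e'
      refine e'.trans ?_
      simp [Matrix.one_apply, Fin.ext_iff]
    · rw [mem_normGrp_stabF_iff.1 n.2 _ _ i.2 (not_lt.1 ha), if_neg]
      rintro rfl
      exact ha i.2
  · intro e
    ext i j
    rw [topBlockHom_apply, e]
    simp [Matrix.one_apply]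

/-- As `n` has determinant one, the inverse of the upper determinant is the lower one, a polynomial
in the entries. Thus the generator `1/det` of `glAlg` pulls back to a regular function. -/
theorem det_topBlockHom_inv (h : s ≤ m) (n : NormGrp (stabF K h)) :
    ((topBlockHom h n).1.det)⁻¹ =
      (n.1.1.submatrix (blockEquiv h ∘ Sum.inr) (blockEquiv h ∘ Sum.inr)).det := by
  have key : n.1.1.submatrix (blockEquiv h) (blockEquiv h) =
      Matrix.fromBlocks (topBlockHom h n).1
        (n.1.1.submatrix (blockEquiv h ∘ Sum.inl) (blockEquiv h ∘ Sum.inr)) 0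
        (n.1.1.submatrix (blockEquiv h ∘ Sum.inr) (blockEquiv h ∘ Sum.inr)) := by
    ext (i | i) (j | j)
    · simp [topBlockHom_apply, blockEquiv_inl]
    · simp
    · simp only [Matrix.submatrix_apply, Matrix.fromBlocks_apply₂₁, Matrix.zero_apply]
      exact mem_normGrp_stabF_iff.1 n.2 _ _ (by rw [blockEquiv_inl]; exact j.2)
        (by rw [blockEquiv_inr_val]; omega)
    · simp
  have h1 := congrArg Matrix.det key
  rw [Matrix.det_submatrix_equiv_self, n.1.2, Matrix.det_fromBlocks_zero₂₁] at h1
  exact inv_eq_of_mul_eq_one_right h1.symm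

/-- The columns of an `s × s` matrix, extended by zero to vectors of length `m`. -/
def extendedCols (P : Matrix (Fin s) (Fin s) K) : Fin s → Fin m → K :=
  fun i a => if ha : (a : ℕ) < s then P ⟨a, ha⟩ i else 0

theorem det_replaceCols_extendedCols (h : s ≤ m) (P : Matrix (Fin s) (Fin s) K) :
    (replaceCols (1 : Matrix (Fin m) (Fin m) K) (extendedCols P)).det = P.det := by
  have key : (replaceCols (1 : Matrix (Fin m) (Fin m) K) (extendedCols P)).submatrix
      (blockEquiv h) (blockEquiv h) = Matrix.fromBlocks P 0 0 1 := by
    ext (i | i) (j | j)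
    · simp [replaceCols, extendedCols, blockEquiv_inl]
    · have hne : Fin.castLE h i ≠ blockEquiv h (Sum.inr j) := by
        rw [← blockEquiv_inl]
        exact fun e => by simpa using (blockEquiv h).injective e
      simp [replaceCols, blockEquiv_inl, blockEquiv_inr_val, hne]
    · simp [replaceCols, extendedCols, blockEquiv_inl, blockEquiv_inr_val]
    · simp [replaceCols, blockEquiv_inr_val, Matrix.one_apply]
  rw [← Matrix.det_submatrix_equiv_self (blockEquiv h), key]
  simp

/-- A section of the upper left block homomorphism. -/
noncomputable def blockSection (h : s < m) (P : Matrix.GeneralLinearGroup (Fin s) K) : SLm K m :=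
  slCols h 1 (extendedCols P.1)

theorem det_replaceCols_extendedCols_ne_zero (h : s ≤ m)
    (P : Matrix.GeneralLinearGroup (Fin s) K) :
    (replaceCols (1 : Matrix (Fin m) (Fin m) K) (extendedCols P.1)).det ≠ 0 := by
  rw [det_replaceCols_extendedCols h]
  exact ((Matrix.isUnit_iff_isUnit_det _).1 P.isUnit).ne_zero

theorem blockSection_apply (h : s < m) (P : Matrix.GeneralLinearGroup (Fin s) K) (a : Fin m)
    (i : Fin s) : (blockSection h P).1 a (Fin.castLE h.le i) = extendedCols P.1 i a := by
  rw [← diagAct_stdTuple h.le, blockSection,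
    diagAct_slCols h (det_replaceCols_extendedCols_ne_zero h.le P)]

theorem blockSection_mem_normGrp (h : s < m) (P : Matrix.GeneralLinearGroup (Fin s) K) :
    blockSection h P ∈ NormGrp (stabF K h.le) := by
  rw [mem_normGrp_stabF_iff]
  intro a b hb ha
  have := blockSection_apply h P a ⟨b, hb⟩
  rw [extendedCols, dif_neg (not_lt.2 ha)] at this
  exact this

theorem topBlockHom_blockSection (h : s < m) (P : Matrix.GeneralLinearGroup (Fin s) K) :
    topBlockHom h.le ⟨blockSection h P, blockSection_mem_normGrp h P⟩ = P := by
  ext i j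
  rw [topBlockHom_apply, blockSection_apply, extendedCols]
  simp

theorem entry_mem_glAlg (i j : Fin s) :
    (fun g : Matrix.GeneralLinearGroup (Fin s) K => g.1 i j) ∈ glAlg K s :=
  Algebra.subset_adjoin (Or.inl ⟨(i, j), rfl⟩)

theorem det_inv_mem_glAlg :
    (fun g : Matrix.GeneralLinearGroup (Fin s) K => (g.1.det)⁻¹) ∈ glAlg K s :=
  Algebra.subset_adjoin (Or.inr rfl)

/-- The section is the block matrix `diag(P, 1/det P, 1, …, 1)`, so `1/det P` is the only
denominator. -/
theorem comp_blockSection_mem (h : s < m) {f : SLm K m → K} (hf : f ∈ slAlg K m) :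
    f ∘ blockSection h ∈ glAlg K s := by
  refine comp_mem_of_entries _ _ (fun a b => ?_) hf
  have hval : ∀ P : Matrix.GeneralLinearGroup (Fin s) K,
      (blockSection h P).1 = normalizedCols 1 (extendedCols P.1) := fun P =>
    slCols_val h (det_replaceCols_extendedCols_ne_zero h.le P)
  rw [show (fun P => (blockSection h P).1 a b) =
    fun P : Matrix.GeneralLinearGroup (Fin s) K => normalizedCols 1 (extendedCols P.1) a b from
    funext fun P => by rw [hval]]
  refine normalizedCols_mem (glAlg K s) (fun _ => 1) (fun P => extendedCols P.1)
    (fun a b => Subalgebra.algebraMap_mem _ ((1 : Matrix (Fin m) (Fin m) K) a b))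
    (fun i a => ?_) ?_ a b
  · simp only [extendedCols]
    split_ifs
    · exact entry_mem_glAlg _ _
    · exact Subalgebra.zero_mem _
  · simp only [det_replaceCols_extendedCols h.le]
    exact det_inv_mem_glAlg

/-- The isomorphism `N_G(F)/F ≅ GL(s)` given by the upper left block. -/
noncomputable def normQuotEquiv (h : s < m) :
    NormQuot (stabF K h.le) ≃* Matrix.GeneralLinearGroup (Fin s) K :=
  MulEquiv.ofBijective
    (QuotientGroup.lift ((stabF K h.le).subgroupOf (NormGrp (stabF K h.le))) (topBlockHom h.le)
      fun n hn => (topBlockHom_eq_one_iff h.le n).2 (Subgroup.mem_subgroupOf.1 hn)) <| by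
    constructor
    · refine (injective_iff_map_eq_one _).2 ?_
      rintro ⟨n⟩ hn
      exact (QuotientGroup.eq_one_iff n).2
        (Subgroup.mem_subgroupOf.2 ((topBlockHom_eq_one_iff h.le n).1 hn))
    · exact fun P => ⟨normProj _ ⟨_, blockSection_mem_normGrp h P⟩, topBlockHom_blockSection h P⟩

/-- Generators of `glAlg` pull back to regular functions on the normalizer; conversely, a function
whose pullback extends to a regular `H` on `SL(m)` is recovered as `H ∘ blockSection h`. -/
theorem isAffineIso_normQuotEquiv (h : s < m) :
    IsAffineIso (normQuotAlg (stabF K h.le)) (glAlg K s) (normQuotEquiv h) := by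
  refine ⟨(normQuotEquiv h).bijective, fun f => ⟨fun hf => ?_, ?_⟩⟩
  · have key : glAlg K s ≤ (normAlg (stabF K h.le)).comap (pullbackFun K (topBlockHom h.le)) := by
      refine Algebra.adjoin_le ?_
      rintro _ (⟨⟨i, j⟩, rfl⟩ | rfl)
      · exact ⟨_, entry_mem_slAlg (Fin.castLE h.le i) (Fin.castLE h.le j), rfl⟩
      · refine ⟨_, det_fun_mem (slAlg K m) (fun g =>
          g.1.submatrix (blockEquiv h.le ∘ Sum.inr) (blockEquiv h.le ∘ Sum.inr))
          fun i j => entry_mem_slAlg _ _, funext fun n => ?_⟩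
        exact (det_topBlockHom_inv h.le n).symm
    exact key hf
  · rintro ⟨H, hH, e⟩
    have : f = H ∘ blockSection h := by
      funext P
      have := congrFun e ⟨blockSection h P, blockSection_mem_normGrp h P⟩
      refine Eq.trans ?_ this.symm
      exact congrArg f (topBlockHom_blockSection h P).symm
    exact this ▸ comp_blockSection_mem h hH

end Normalizer

/-! ### The torus `T_F`: parametrization and maximality. -/

section Torus

variable {K : Type*} [Field K] {m s : ℕ}

theorem torusHom_val (h : s < m) (t : Fin s → Kˣ) :
    (torusHom K h t).1 = Matrix.diagonal fun a => (torusDiag t a : K) := rfl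

theorem torusHom_mem_normGrp (h : s < m) (t : Fin s → Kˣ) :
    torusHom K h t ∈ NormGrp (stabF K h.le) := by
  rw [mem_normGrp_stabF_iff]
  intro a b hb ha
  rw [torusHom_val]
  refine Matrix.diagonal_apply_ne _ ?_
  rintro rfl
  omega

theorem torusHom_range_le (h : s < m) : (torusHom K h).range ≤ NormGrp (stabF K h.le) := by
  rintro _ ⟨t, rfl⟩
  exact torusHom_mem_normGrp h t

/-- The parametrization of `T'_F`. -/
def torusParam' (h : s < m) (t : Fin s → Kˣ) : torusT' K h :=
  ⟨⟨torusHom K h t, torusHom_mem_normGrp h t⟩, Subgroup.mem_subgroupOf.2 ⟨t, rfl⟩⟩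

theorem torusParam'_surjective (h : s < m) : Function.Surjective (torusParam' (K := K) h) := by
  rintro ⟨n, hn⟩
  obtain ⟨t, ht⟩ := Subgroup.mem_subgroupOf.1 hn
  exact ⟨t, Subtype.ext (Subtype.ext ht)⟩

/-- The parametrization of `T_F`. -/
def torusParam (h : s < m) : (Fin s → Kˣ) →* torusT K h where
  toFun t := (normProj (stabF K h.le)).subgroupMap (torusT' K h) (torusParam' h t)
  map_one' := by
    rw [show torusParam' (K := K) h 1 = 1 from
      Subtype.ext (Subtype.ext (map_one (torusHom K h)))]
    exact map_one _
  map_mul' t t' := by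
    rw [show torusParam' (K := K) h (t * t') = torusParam' h t * torusParam' h t' from
      Subtype.ext (Subtype.ext (map_mul (torusHom K h) t t'))]
    exact map_mul _ _ _

theorem normQuotEquiv_torusParam (h : s < m) (t : Fin s → Kˣ) (i j : Fin s) :
    (normQuotEquiv h (torusParam h t)).1 i j = if i = j then (t i : K) else 0 := by
  change (torusHom K h t).1 (Fin.castLE h.le i) (Fin.castLE h.le j) = _
  rw [torusHom_val, Matrix.diagonal_apply]
  simp [torusDiag]

theorem torusParam_bijective (h : s < m) : Function.Bijective (torusParam (K := K) h) := by
  constructor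
  · intro t t' e
    funext i
    have h1 := normQuotEquiv_torusParam h t i i
    rw [e, normQuotEquiv_torusParam, if_pos rfl, if_pos rfl] at h1
    exact Units.ext h1.symm
  · exact ((normProj (stabF K h.le)).subgroupMap_surjective (torusT' K h)).comp
      (torusParam'_surjective h)

theorem coord_mem_laurentAlg (i : Fin s) :
    (fun t : Fin s → Kˣ => (t i : K)) ∈ laurentAlg K s :=
  Algebra.subset_adjoin (Or.inl ⟨i, rfl⟩)

theorem coord_inv_mem_laurentAlg (i : Fin s) :
    (fun t : Fin s → Kˣ => ((t i)⁻¹ : K)) ∈ laurentAlg K s :=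
  Algebra.subset_adjoin (Or.inr ⟨i, rfl⟩)

theorem comp_torusHom_mem (h : s < m) {f : SLm K m → K} (hf : f ∈ slAlg K m) :
    f ∘ torusHom K h ∈ laurentAlg K s := by
  refine comp_mem_of_entries _ _ (fun a b => ?_) hf
  simp only [torusHom_val, Matrix.diagonal_apply, torusDiag]
  split_ifs
  · exact coord_mem_laurentAlg _
  · simp only [Units.val_inv_eq_inv_val, Units.coe_prod, ← Finset.prod_inv_distrib]
    exact prod_fun_mem _ _ _ fun i _ => coord_inv_mem_laurentAlg i
  · exact Subalgebra.one_mem _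
  · exact Subalgebra.zero_mem _

theorem entry_mem_normQuotAlg (h : s < m) (i j : Fin s) :
    (fun q => (normQuotEquiv h q).1 i j) ∈ normQuotAlg (stabF K h.le) :=
  ((isAffineIso_normQuotEquiv h).2 _).1 (entry_mem_glAlg i j)

theorem isAffineIso_torusParam (h : s < m) : IsAffineIso (laurentAlg K s)
    (restrictAlg (normQuotAlg (stabF K h.le)) (torusT K h : Set (NormQuot (stabF K h.le))))
    (torusParam h) := by
  refine ⟨torusParam_bijective h, fun f => ⟨?_, fun hf => ?_⟩⟩
  · rintro ⟨g, ⟨H, hH, e⟩, rfl⟩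
    have : (pullbackFun K Subtype.val g) ∘ torusParam h = H ∘ torusHom K h :=
      funext fun t => (congrFun e ⟨_, torusHom_mem_normGrp h t⟩).symm
    exact this ▸ comp_torusHom_mem h hH
  · have key : laurentAlg K s ≤ (normQuotAlg (stabF K h.le)).map
        (pullbackFun K fun t => (torusParam h t : NormQuot (stabF K h.le))) := by
      refine Algebra.adjoin_le ?_
      rintro _ (⟨i, rfl⟩ | ⟨i, rfl⟩)
      · refine ⟨_, entry_mem_normQuotAlg h i i, funext fun t => ?_⟩
        exact (normQuotEquiv_torusParam h t i i).trans (if_pos rfl)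
      · refine ⟨(fun q => ((normQuotEquiv h q).1.det)⁻¹) *
          fun q => ∏ j ∈ Finset.univ.erase i, (normQuotEquiv h q).1 j j,
          Subalgebra.mul_mem _ (((isAffineIso_normQuotEquiv h).2 _).1 det_inv_mem_glAlg)
            (prod_fun_mem _ _ _ fun j _ => entry_mem_normQuotAlg h j j), funext fun t => ?_⟩
        have hdiag : (normQuotEquiv h (torusParam h t)).1
            = Matrix.diagonal fun j => (t j : K) := by
          ext a b
          rw [normQuotEquiv_torusParam, Matrix.diagonal_apply]
        change ((normQuotEquiv h (torusParam h t)).1.det)⁻¹ *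
          ∏ j ∈ Finset.univ.erase i, (normQuotEquiv h (torusParam h t)).1 j j = ((t i : K))⁻¹
        rw [hdiag, Matrix.det_diagonal, ← Finset.mul_prod_erase _ _ (Finset.mem_univ i)]
        simp only [Matrix.diagonal_apply_eq]
        rw [mul_inv, mul_assoc, inv_mul_cancel₀, mul_one]
        exact Finset.prod_ne_zero_iff.2 fun j _ => (t j).ne_zero
    obtain ⟨g, hg, e⟩ := key hf
    refine ⟨g, hg, funext fun q => ?_⟩
    obtain ⟨t, rfl⟩ := (torusParam_bijective h).2 q
    exact congrFun e t

/-- Both groups are parametrized by `(K^*)^s`, so regularity is tested after pulling back to Laurent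
polynomials. -/
theorem isAffineIso_subgroupMap_torusT' (h : s < m) :
    IsAffineIso
      (restrictAlg (normAlg (stabF K h.le)) (torusT' K h : Set (NormGrp (stabF K h.le))))
      (restrictAlg (normQuotAlg (stabF K h.le)) (torusT K h : Set (NormQuot (stabF K h.le))))
      ((normProj (stabF K h.le)).subgroupMap (torusT' K h)) := by
  refine ⟨⟨fun x y e => ?_, (normProj (stabF K h.le)).subgroupMap_surjective _⟩,
    fun f => ⟨?_, ?_⟩⟩
  · obtain ⟨t, rfl⟩ := torusParam'_surjective h x
    obtain ⟨t', rfl⟩ := torusParam'_surjective h y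
    exact congrArg _ ((torusParam_bijective h).1 e)
  · rintro ⟨g, hg, rfl⟩
    exact ⟨_, hg, rfl⟩
  · rintro ⟨_, ⟨H, hH, rfl⟩, e⟩
    refine ((isAffineIso_torusParam h).2 f).2 ?_
    have : f ∘ torusParam h = H ∘ torusHom K h :=
      funext fun t => (congrFun e (torusParam' h t)).symm
    exact this ▸ comp_torusHom_mem h hH

/-- `T_F` becomes the full diagonal torus of `GL(s)`; this yields both its equations and the
criterion used for maximality. -/
theorem mem_torusT_iff (h : s < m) (q : NormQuot (stabF K h.le)) :
    q ∈ torusT K h ↔ ∀ i j, i ≠ j → (normQuotEquiv h q).1 i j = 0 := by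
  constructor
  · intro hq i j hij
    obtain ⟨t, ht⟩ := (torusParam_bijective h).2 ⟨q, hq⟩
    have := normQuotEquiv_torusParam h t i j
    rw [ht, if_neg hij] at this
    exact this
  · intro hq
    have hdiag : (normQuotEquiv h q).1 = Matrix.diagonal fun i => (normQuotEquiv h q).1 i i := by
      ext i j
      rw [Matrix.diagonal_apply]
      split_ifs with hij
      · rw [hij]
      · exact hq i j hij
    have hdet : (normQuotEquiv h q).1.det ≠ 0 :=
      ((Matrix.isUnit_iff_isUnit_det _).1 (normQuotEquiv h q).isUnit).ne_zero
    rw [hdiag, Matrix.det_diagonal, Finset.prod_ne_zero_iff] at hdet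
    let t : Fin s → Kˣ := fun i => Units.mk0 _ (hdet i (Finset.mem_univ i))
    have : q = torusParam h t := by
      apply (normQuotEquiv h).injective
      ext i j
      rw [normQuotEquiv_torusParam, hdiag, Matrix.diagonal_apply]
      rfl
    rw [this]
    exact (torusParam h t).2

theorem isTorus_torusT (h : s < m) : IsTorus (normQuotAlg (stabF K h.le)) (torusT K h) := by
  refine ⟨isClosed_zariski_of_eqs (ι := {p : Fin s × Fin s // p.1 ≠ p.2}) _ _
    (fun p q => (normQuotEquiv h q).1 p.1.1 p.1.2) (fun p => entry_mem_normQuotAlg h _ _)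
    fun q => ?_, s, torusParam h, isAffineIso_torusParam h⟩
  rw [SetLike.mem_coe, mem_torusT_iff]
  exact ⟨fun hq p => hq _ _ p.2, fun hq i j hij => hq ⟨(i, j), hij⟩⟩

theorem IsTorus.mul_comm {Q : Type*} [Group Q] {A : Subalgebra K (Q → K)} {T : Subgroup Q}
    (hT : IsTorus A T) {x y : Q} (hx : x ∈ T) (hy : y ∈ T) : x * y = y * x := by
  obtain ⟨_, r, e, he, _⟩ := hT
  obtain ⟨t, ht⟩ := he.2 ⟨x, hx⟩
  obtain ⟨t', ht'⟩ := he.2 ⟨y, hy⟩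
  have : (⟨x, hx⟩ : T) * ⟨y, hy⟩ = ⟨y, hy⟩ * ⟨x, hx⟩ := by
    rw [← ht, ← ht', ← map_mul, ← map_mul, _root_.mul_comm]
  exact congrArg Subtype.val this

/-- Tori are commutative, so a torus containing `T_F` centralizes it, and the diagonal torus is its
own centralizer. -/
theorem isMaximalTorus_torusT [Infinite K] (h : s < m) :
    IsMaximalTorus (normQuotAlg (stabF K h.le)) (torusT K h) := by
  refine ⟨isTorus_torusT h, fun T hT hle q hq => ?_⟩
  rw [mem_torusT_iff]
  intro i j hij
  classical
  -- Commuting with the diagonal matrix having `u` in position `i` and `1` elsewhere gives `q_ij = u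
  -- * q_ij`; `u ≠ 0` makes it invertible and `u ≠ 1` forces `q_ij = 0`.
  obtain ⟨u, hu⟩ := Infinite.exists_notMem_finset ({0, 1} : Finset K)
  simp only [Finset.mem_insert, Finset.mem_singleton, not_or] at hu
  let t : Fin s → Kˣ := Function.update 1 i (Units.mk0 u hu.1)
  have hcomm := congrArg (normQuotEquiv h) (hT.mul_comm hq (hle (torusParam h t).2))
  rw [map_mul, map_mul] at hcomm
  have hdiag : (normQuotEquiv h (torusParam h t)).1 = Matrix.diagonal fun j => (t j : K) := by
    ext a b
    rw [normQuotEquiv_torusParam, Matrix.diagonal_apply]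
  have hij' := congrArg (fun P : Matrix.GeneralLinearGroup (Fin s) K => P.1 i j) hcomm
  beta_reduce at hij'
  rw [Units.val_mul, Units.val_mul, hdiag, Matrix.mul_diagonal, Matrix.diagonal_mul] at hij'
  simp only [t, Function.update_self, Function.update_of_ne hij.symm, Pi.one_apply, Units.val_one,
    mul_one, Units.val_mk0] at hij'
  have : (u - 1) * (normQuotEquiv h q).1 i j = 0 := by
    rw [sub_mul, ← hij', one_mul, sub_self]
  exact (mul_eq_zero.1 this).resolve_left (sub_ne_zero.2 hu.2)

end Torus

/-! ### Cones of characters and rescaling of variables. -/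

section CharacterCones

variable {K : Type*} [Field K]

theorem tmul_mem_charCone {T : Type*} [Group T] {A : Subalgebra K (T → K)}
    {S : Set (charGroup A)} {χ : charGroup A} (hχ : χ ∈ S) :
    (TensorProduct.tmul ℤ (1 : ℚ) (Additive.ofMul χ) : RatChar A) ∈ charCone A S :=
  Submodule.subset_span ⟨χ, hχ, rfl⟩

/-- In additive notation the product is a combination with coefficients in `ℕ`; this places weights
of monomials in the cone. -/
theorem tmul_prod_mem_charCone {T ι : Type*} [Group T] {A : Subalgebra K (T → K)}
    {S : Set (charGroup A)} (I : Finset ι) (χ : ι → charGroup A) (u : ι → ℕ)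
    (hχ : ∀ i ∈ I, χ i ∈ S) :
    (TensorProduct.tmul ℤ (1 : ℚ) (Additive.ofMul (∏ i ∈ I, χ i ^ u i)) : RatChar A)
      ∈ charCone A S := by
  have : (TensorProduct.tmul ℤ (1 : ℚ) (Additive.ofMul (∏ i ∈ I, χ i ^ u i)) : RatChar A)
      = ∑ i ∈ I, u i • TensorProduct.tmul ℤ (1 : ℚ) (Additive.ofMul (χ i)) := by
    rw [ofMul_prod]
    change TensorProduct.mk ℤ ℚ (Additive (charGroup A)) 1 _ = _
    rw [map_sum]
    refine Finset.sum_congr rfl fun i _ => ?_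
    rw [ofMul_pow, map_nsmul]
    rfl
  rw [this]
  exact Submodule.sum_mem _ fun i hi => Submodule.smul_of_tower_mem _ _ (tmul_mem_charCone (hχ i hi))

/-- Passes from the index set of pairs to the `Fin r` demanded by `IsSuitable`. -/
theorem IsSuitableSystem.comp_equiv {m : ℕ} {F : Subgroup (SLm K m)} {T : Subgroup (NormQuot F)}
    {ι κ : Type*} {f : ι → invAlg F} (hf : IsSuitableSystem T f) (e : κ ≃ ι) :
    IsSuitableSystem T (f ∘ e) := by
  obtain ⟨hfin, hprime, hadj, χ, hχ, hJ⟩ := hf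
  refine ⟨Finite.of_equiv ι e.symm, fun i => hprime (e i), ?_, χ ∘ e, fun i => hχ (e i),
    fun J => ?_⟩
  · rw [EquivLike.range_comp, hadj]
  · obtain ⟨z, hz⟩ := hJ (e '' J)
    exact ⟨z, by rw [hz, Set.image_image]; rfl⟩

/-- Rescaling variables is diagonal in the monomial basis, so weights can be compared coefficient by
coefficient. -/
theorem coeff_aeval_C_mul_X {σ : Type*} (a : σ → K) (Q : MvPolynomial σ K) (u : σ →₀ ℕ) :
    MvPolynomial.coeff u (MvPolynomial.aeval (fun p => MvPolynomial.C (a p) * MvPolynomial.X p) Q)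
      = (u.prod fun p n => a p ^ n) * MvPolynomial.coeff u Q := by
  classical
  induction Q using MvPolynomial.induction_on' with
  | monomial v c =>
    have : MvPolynomial.aeval (fun p => MvPolynomial.C (a p) * MvPolynomial.X p)
        (MvPolynomial.monomial v c) = MvPolynomial.C (v.prod fun p n => a p ^ n) *
          MvPolynomial.monomial v c := by
      rw [MvPolynomial.aeval_monomial, MvPolynomial.algebraMap_eq, MvPolynomial.monomial_eq]
      simp only [mul_pow, Finsupp.prod, Finset.prod_mul_distrib, map_prod, map_pow]
      ring
    rw [this, MvPolynomial.coeff_C_mul, MvPolynomial.coeff_monomial]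
    split_ifs with huv
    · rw [huv]
    · simp
  | add p q hp hq => rw [map_add, MvPolynomial.coeff_add, hp, hq, MvPolynomial.coeff_add, mul_add]

end CharacterCones

/-! ### Points of `Z`, weights of the coordinates, and orbit cones. -/

section OrbitCones

variable {K : Type*} [Field K] {m s : ℕ}

theorem zPt_aeval_coordFun (h : s ≤ m) (z : ZPt (stabF K h))
    (Q : MvPolynomial (Fin s × Fin m) K) :
    z (MvPolynomial.aeval (coordFun K h) Q)
      = MvPolynomial.eval (fun p => zCoord K h z p.1 p.2) Q := by
  have : z.comp (MvPolynomial.aeval (coordFun K h))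
      = MvPolynomial.aeval fun p => zCoord K h z p.1 p.2 := by
    ext p
    simp only [AlgHom.comp_apply, MvPolynomial.aeval_X]
    rfl
  exact DFunLike.congr_fun this Q

/-- An algebra homomorphism from a polynomial ring to `K` amounts to arbitrary values for the
variables. -/
theorem bijective_zCoord [Infinite K] (h : s < m) : Function.Bijective (zCoord K h.le) := by
  have hb := bijective_aeval_coordFun (K := K) h
  constructor
  · intro z z' e
    refine AlgHom.ext fun f => ?_
    obtain ⟨Q, rfl⟩ := hb.2 f
    rw [zPt_aeval_coordFun, zPt_aeval_coordFun, e]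
  · intro v
    refine ⟨(MvPolynomial.aeval fun p : Fin s × Fin m => v p.1 p.2).comp
      (AlgEquiv.ofBijective _ hb).symm.toAlgHom, ?_⟩
    funext i a
    have : (AlgEquiv.ofBijective _ hb).symm (coordFun K h.le (i, a)) = MvPolynomial.X (i, a) := by
      rw [AlgEquiv.symm_apply_eq]
      simp
    change MvPolynomial.aeval _ ((AlgEquiv.ofBijective _ hb).symm (coordFun K h.le (i, a))) = _
    rw [this, MvPolynomial.aeval_X]

theorem zCoord_ofGroup (h : s ≤ m) (g : SLm K m) :
    zCoord K h (ZPt.ofGroup (stabF K h) g) = diagAct g (stdTuple K h) := rfl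

/-- The action translates functions on the right by `n⁻¹`, which multiplies column `i` of the
argument by `t_i⁻¹`. -/
theorem zCoord_zAct (h : s < m) (t : Fin s → Kˣ) (n : NormGrp (stabF K h.le))
    (hn : (n : SLm K m) = torusHom K h t) (z : ZPt (stabF K h.le)) (i : Fin s) :
    zCoord K h.le (zAct (normProj (stabF K h.le) n) z) i = ((t i)⁻¹ : K) • zCoord K h.le z i := by
  funext a
  have key : normQuotRep (stabF K h.le) (normProj (stabF K h.le) n)⁻¹ (coordFun K h.le (i, a))
      = ((t i)⁻¹ : K) • coordFun K h.le (i, a) := by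
    refine Subtype.ext (funext fun g => ?_)
    change diagAct (g * (n : SLm K m)⁻¹) (stdTuple K h.le) i a
      = ((t i)⁻¹ : K) * diagAct g (stdTuple K h.le) i a
    rw [diagAct_stdTuple, diagAct_stdTuple, hn, ← map_inv, Matrix.SpecialLinearGroup.coe_mul,
      torusHom_val, Matrix.mul_diagonal, _root_.mul_comm]
    simp [torusDiag]
  change z (normQuotRep (stabF K h.le) (normProj (stabF K h.le) n)⁻¹ (coordFun K h.le (i, a))) = _
  rw [key, map_smul]
  rfl

theorem zCoord_zAct_torusParam (h : s < m) (t : Fin s → Kˣ) (z : ZPt (stabF K h.le)) (i : Fin s) :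
    zCoord K h.le (zAct (torusParam h t : NormQuot (stabF K h.le)) z) i
      = ((t i)⁻¹ : K) • zCoord K h.le z i :=
  zCoord_zAct h t (torusParam' h t) rfl z i

theorem torusParam_symm_apply (h : s < m) (t : Fin s → Kˣ) :
    (MulEquiv.ofBijective (torusParam h) (torusParam_bijective h)).symm (torusParam h t) = t :=
  (MulEquiv.symm_apply_eq _).2 rfl

/-- The weight `t ↦ t_i⁻¹` of the coordinate functions of `v_i`. -/
noncomputable def coordWeight (K : Type*) [Field K] {m s : ℕ} (h : s < m) (i : Fin s) :
    TChar (torusT K h) :=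
  ⟨((Pi.evalMonoidHom (fun _ : Fin s => Kˣ) i).comp
    (MulEquiv.ofBijective (torusParam h) (torusParam_bijective h)).symm.toMonoidHom)⁻¹, by
    constructor <;> rw [(isAffineIso_torusParam h).2]
    · convert coord_inv_mem_laurentAlg i with t
      simp [torusParam_symm_apply]
    · convert coord_mem_laurentAlg i with t
      simp [torusParam_symm_apply]⟩

theorem coordWeight_torusParam (h : s < m) (i : Fin s) (t : Fin s → Kˣ) :
    (coordWeight K h i).1 (torusParam h t) = (t i)⁻¹ :=
  congrArg (fun t' : Fin s → Kˣ => (t' i)⁻¹) (torusParam_symm_apply h t)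

theorem isHomogOfWeight_coordFun (h : s < m) (p : Fin s × Fin m) :
    IsHomogOfWeight (torusT K h) (coordWeight K h p.1) (coordFun K h.le p) := by
  intro t z
  obtain ⟨t, rfl⟩ := (torusParam_bijective h).2 t
  rw [coordWeight_torusParam, Units.val_inv_eq_inv_val]
  exact congrFun (zCoord_zAct_torusParam h t z p.1) p.2

/-- The weight of a homogeneous polynomial is the weight of each of its monomials. -/
theorem eq_prod_coordWeight [Infinite K] (h : s < m) {χ : TChar (torusT K h)}
    {Q : MvPolynomial (Fin s × Fin m) K}
    (hQ : IsHomogOfWeight (torusT K h) χ (MvPolynomial.aeval (coordFun K h.le) Q))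
    {u : Fin s × Fin m →₀ ℕ} (hu : MvPolynomial.coeff u Q ≠ 0) :
    χ = ∏ p ∈ u.support, coordWeight K h p.1 ^ u p := by
  refine Subtype.ext (MonoidHom.ext fun t => ?_)
  obtain ⟨t, rfl⟩ := (torusParam_bijective h).2 t
  -- Homogeneity is an identity of values on `Z`; since `Z` fills affine space and `K` is infinite,
  -- it is an identity of polynomials.
  have hscale : MvPolynomial.aeval
      (fun p : Fin s × Fin m => MvPolynomial.C ((t p.1)⁻¹ : K) * MvPolynomial.X p) Q
        = MvPolynomial.C ((χ.1 (torusParam h t) : Kˣ) : K) * Q := by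
    refine MvPolynomial.funext fun x => ?_
    obtain ⟨z, hz⟩ := (bijective_zCoord h).2 fun i a => x (i, a)
    have e := hQ (torusParam h t) z
    rw [zPt_aeval_coordFun, zPt_aeval_coordFun] at e
    simp only [zCoord_zAct_torusParam, hz] at e
    rw [map_mul, MvPolynomial.eval_C]
    refine Eq.trans ?_ e
    have : (MvPolynomial.aeval x).comp (MvPolynomial.aeval
        (fun p : Fin s × Fin m => MvPolynomial.C ((t p.1)⁻¹ : K) * MvPolynomial.X p))
        = MvPolynomial.aeval fun p => ((t p.1)⁻¹ : K) * x p := by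
      ext p
      simp
    exact DFunLike.congr_fun this Q
  have hcoeff := congrArg (MvPolynomial.coeff u) hscale
  rw [coeff_aeval_C_mul_X, MvPolynomial.coeff_C_mul] at hcoeff
  have hval := (mul_right_cancel₀ hu hcoeff).symm
  refine Units.ext (hval.trans ?_)
  simp only [Finsupp.prod, Subgroup.val_finsetProd, Subgroup.coe_pow, MonoidHom.finsetProd_apply,
    MonoidHom.pow_apply, coordWeight_torusParam, Units.coe_prod, Units.val_pow_eq_pow_val,
    Units.val_inv_eq_inv_val]

/-- The orbit cone of the point whose coordinates are `1` on `J` and `0` elsewhere. -/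
theorem exists_orbitCone_eq [Infinite K] (h : s < m) (J : Set (Fin s × Fin m)) :
    ∃ z : ZPt (stabF K h.le), orbitCone (torusT K h) z
      = charCone _ ((fun p => coordWeight K h p.1) '' J) := by
  classical
  obtain ⟨z, hz⟩ := (bijective_zCoord (K := K) h).2 fun i a => if (i, a) ∈ J then 1 else 0
  refine ⟨z, le_antisymm (Submodule.span_le.2 ?_) (Submodule.span_mono (Set.image_mono ?_))⟩
  · rintro _ ⟨χ, ⟨f, hf, hfz⟩, rfl⟩
    obtain ⟨Q, rfl⟩ := (bijective_aeval_coordFun h).2 f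
    rw [zPt_aeval_coordFun, hz, MvPolynomial.eval_eq] at hfz
    -- A nonzero value needs a monomial that does not vanish at `z`; its variables lie in `J`, and
    -- its weight is the weight of `f`.
    obtain ⟨u, _, hu⟩ := Finset.exists_ne_zero_of_sum_ne_zero hfz
    have hcoeff := left_ne_zero_of_mul hu
    have hprod := Finset.prod_ne_zero_iff.1 (right_ne_zero_of_mul hu)
    have hJ : ∀ p ∈ u.support, p ∈ J := by
      intro p hp
      by_contra hpJ
      refine hprod p hp ?_
      beta_reduce
      rw [if_neg hpJ, zero_pow (Finsupp.mem_support_iff.1 hp)]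
    rw [eq_prod_coordWeight h hf hcoeff]
    exact tmul_prod_mem_charCone u.support (fun p => coordWeight K h p.1) u
      fun p hp => ⟨p, hJ p hp, rfl⟩
  · rintro _ ⟨p, hp, rfl⟩
    refine ⟨coordFun K h.le p, isHomogOfWeight_coordFun h p, ?_⟩
    have : z (coordFun K h.le p) = 1 :=
      (congrFun (congrFun hz p.1) p.2).trans (if_pos hp)
    rw [this]
    exact one_ne_zero

theorem prime_coordFun [Infinite K] (h : s < m) (p : Fin s × Fin m) :
    Prime (coordFun K h.le p) := by
  have := (MulEquiv.prime_iff (AlgEquiv.ofBijective _ (bijective_aeval_coordFun (K := K) h))).2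
    (MvPolynomial.X_prime (i := p))
  simpa using this

theorem isSuitableSystem_coordFun [Infinite K] (h : s < m) :
    IsSuitableSystem (torusT K h) (coordFun K h.le) :=
  ⟨inferInstance, prime_coordFun h, adjoin_range_coordFun h, fun p => coordWeight K h p.1,
    isHomogOfWeight_coordFun h, exists_orbitCone_eq h⟩

theorem isSuitable_stabF [Infinite K] (h : s < m) : IsSuitable (stabF K h.le) :=
  ⟨isZariskiConnected_stabF h, isGrosshans_stabF h, torusT K h, isMaximalTorus_torusT h, s * m, _,
    (isSuitableSystem_coordFun h).comp_equiv finProdFinEquiv.symm⟩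

end OrbitCones

theorem mainTheorem12 (K : Type*) [Field K] [IsAlgClosed K] [CharZero K]
    (m s : ℕ) (h : s < m) :
    -- the isotropy group `F` of `(e_1, …, e_s)` consists of the block matrices `(1, A; 0, B)`
    (∀ g : SLm K m, g ∈ stabF K h.le ↔
      ∃ (A : Matrix (Fin s) (Fin (m - s)) K) (B : Matrix.SpecialLinearGroup (Fin (m - s)) K),
        g.1 = Matrix.reindex (blockEquiv h.le) (blockEquiv h.le) (Matrix.fromBlocks 1 A 0 B.1)) ∧
    -- `F` is a connected Grosshans subgroup
    IsZariskiConnected (stabF K h.le) ∧ IsGrosshans (stabF K h.le) ∧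
    -- `N_G(F)/F` is isomorphic to `GL(s)`, via the upper left block
    (∃ Ψ : NormQuot (stabF K h.le) ≃* Matrix.GeneralLinearGroup (Fin s) K,
      IsAffineIso (normQuotAlg (stabF K h.le)) (glAlg K s) Ψ ∧
      ∀ (n : NormGrp (stabF K h.le)) (i j : Fin s),
        (Ψ (normProj (stabF K h.le) n)).1 i j = n.1.1 (Fin.castLE h.le i) (Fin.castLE h.le j)) ∧
    -- `T'_F` lies in `N_G(F)`, is mapped isomorphically onto `T_F`, and `T_F` is a maximal torus
    (torusHom K h).range ≤ NormGrp (stabF K h.le) ∧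
    IsAffineIso (restrictAlg (normAlg (stabF K h.le)) (torusT' K h : Set (NormGrp (stabF K h.le))))
      (restrictAlg (normQuotAlg (stabF K h.le)) (torusT K h : Set (NormQuot (stabF K h.le))))
      ((normProj (stabF K h.le)).subgroupMap (torusT' K h)) ∧
    IsMaximalTorus (normQuotAlg (stabF K h.le)) (torusT K h) ∧
    -- the orbit map induces an isomorphism of `Z = Spec(𝒪(G)^F)` with `(K^m)^s`
    Function.Bijective
      (MvPolynomial.aeval (coordFun K h.le) :
        MvPolynomial (Fin s × Fin m) K →ₐ[K] invAlg (stabF K h.le)) ∧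
    Function.Bijective (zCoord K h.le) ∧
    (∀ g : SLm K m, zCoord K h.le (ZPt.ofGroup (stabF K h.le) g) = diagAct g (stdTuple K h.le)) ∧
    -- `T_F` acts on `Z` by inverse scaling
    (∀ (t : Fin s → Kˣ) (n : NormGrp (stabF K h.le)), (n : SLm K m) = torusHom K h t →
      ∀ (z : ZPt (stabF K h.le)) (i : Fin s),
        zCoord K h.le (zAct (normProj (stabF K h.le) n) z) i =
          ((t i)⁻¹ : K) • zCoord K h.le z i) ∧
    -- the coordinate functions form a suitable system for `T_F`; in particular, `F` is suitable
    IsSuitableSystem (torusT K h) (coordFun K h.le) ∧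
    IsSuitable (stabF K h.le) := by
  exact ⟨mem_stabF_iff_blocks h.le, isZariskiConnected_stabF h, isGrosshans_stabF h,
    ⟨normQuotEquiv h, isAffineIso_normQuotEquiv h, fun n i j => rfl⟩, torusHom_range_le h,
    isAffineIso_subgroupMap_torusT' h, isMaximalTorus_torusT h, bijective_aeval_coordFun h,
    bijective_zCoord h, zCoord_ofGroup h.le, zCoord_zAct h, isSuitableSystem_coordFun h,
    isSuitable_stabF h⟩
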